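/- **Theorem 6.3 (Perron's method for an integrand containing a factor $(z-z_0)^{a-1}$ for arbitrary $a\in\mathbb C$).** A *contour* $\mathcal C$ is given by a continuous map $c:[0,1]\to\mathbb C$ that is continuously differentiable except at finitely many points, with $c'$ integrable; $\int_{\mathcal C} f(z)\,dz=\int_0^1 f(c(t))c'(t)\,dt$. Powers are principal ($\arg\in(-\pi,\pi]$) unless another branch is specified. Let $\mathcal B$ be a neighborhood of $z_0\in\mathbb C$, let $\mathcal C$ be a contour, and let $p$ be holomorphic on an open set containing $\mathcal B\cup\mathcal C$ and not constant near $z_0$. Write $$p(z)=p(z_0)-p_0(z-z_0)^\mu(1-\phi(z))\qquad(z\in\mathcal B)$$ with $\mu\in\mathbb Z_{\ge1}$, $p_0\in\mathbb C_{\ne0}$, $\phi$ holomorphic on $\mathcal B$ and $\phi(z_0)=0$. Put $\omega_0=\arg p_0$ and $\theta_\ell=-\frac{\omega_0}{\mu}+\frac{2\pi\ell}{\mu}$ for $\ell\in\mathbb Z$. Let $R_p>0$ be such that the closed disk of radius $R_p$ about $z_0$ lies in $\mathcal B$ and $\mathrm{Re}\,p(z_0+re^{i\theta_\ell})<\mathrm{Re}\,p(z_0)$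 for all $r\in(0,R_p]$ and $\ell\in\mathbb Z$ (this is so for all sufficiently small $R_p$). Let $k_1,k_2\in\mathbb Z$. Suppose that $\mathcal C$ starts at $z_1$ and runs to $z_1'=z_0+R_pe^{i\theta_{k_1}}$; then it runs on the circle of radius $R_p$ about $z_0$, turning about $z_0$ through the angle $2\pi(k_2-k_1)/\mu$, to $z_2'=z_0+R_pe^{i\theta_{k_2}}$; finally it runs to $z_2$. Suppose that $\mathrm{Re}\,p(z)<\mathrm{Re}\,p(z_0)$ for all $z$ in the segments of $\mathcal C$ between $z_1$ and $z_1'$ and between $z_2'$ and $z_2$, including endpoints. Let $a\in\mathbb C$. On $\mathcal C$ the branch of $(z-z_0)^{a-1}$ is specified by $(z_1'-z_0)^{a-1}=|z_1'-z_0|^{a-1}e^{i\theta_{k_1}(a-1)}$ at $z=z_1'$ and by continuity along $\mathcal C$ at the other points. Then for every $S\in\mathbb Z_{\ge0}$ and every $N_0>0$ there is a constant $C$ such that for every $q$ holomorphic on an open set containing $\mathcal B\cup\mathcal C$, every bound $K_q$ for $|q|$ on $\mathcal B\cup\mathcal C$, and every real $N\ge N_0$, $$\int_{\mathcal C}e^{N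 p(z)}(z-z_0)^{a-1}q(z)\,dz=e^{N p(z_0)}\left(\sum_{s=0}^{S-1}\Gamma\!\left(\frac{s+a}{\mu}\right)\frac{\alpha_s\left(e^{2\pi i k_2(s+a)/\mu}-e^{2\pi i k_1(s+a)/\mu}\right)}{N^{(s+a)/\mu}}+E\right),\qquad |E|\le C\,\frac{K_q}{N^{(S+\mathrm{Re}\,a)/\mu}},$$ where $$\alpha_s=\frac{1}{\mu\cdot s!}\,p_0^{-(s+a)/\mu}\,\frac{d^s}{dz^s}\left\{q(z)\,(1-\phi(z))^{-(s+a)/\mu}\right\}_{z=z_0}.$$ If $(s+a)/\mu\in\mathbb Z_{\le0}$, then $\Gamma((s+a)/\mu)\left(e^{2\pi i k_2(s+a)/\mu}-e^{2\pi i k_1(s+a)/\mu}\right)$ is not defined and is replaced by $2\pi i(k_2-k_1)(-1)^{(s+a)/\mu}/|(s+a)/\mu|!$. -/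

import Mathlib

open Set Filter Topology MeasureTheory

noncomputable section

namespace Perron

/-- A contour: a continuous map on `[0,1]` which is continuously differentiable except at a finite
number of points, with integrable derivative (so that it has finite length and integration along
it makes sense). -/
structure IsContour (c : ℝ → ℂ) : Prop where
  continuousOn : ContinuousOn c (Icc 0 1)
  piecewise_C1 : ∃ F : Finset ℝ, ∀ t ∈ Ioo (0 : ℝ) 1, t ∉ F →
    DifferentiableAt ℝ c t ∧ ContinuousAt (deriv c) t
  integrable_deriv : IntervalIntegrable (deriv c) volume 0 1

/-- The point set of a contour. -/
def trace (c : ℝ → ℂ) : Set ℂ := c '' Icc 0 1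

/-- The steepest-descent angles `θ_ℓ = -arg(p₀)/μ + 2πℓ/μ`, with the principal argument. -/
def angle (p₀ : ℂ) (μ : ℕ) (ℓ : ℤ) : ℝ :=
  -Complex.arg p₀ / μ + 2 * Real.pi * ℓ / μ

/-- On the neighbourhood `nb` of `z₀` the function `p` has the form
`p(z) = p(z₀) - p₀ (z - z₀)^μ (1 - φ(z))` with `μ ≥ 1`, `p₀ ≠ 0`,
`φ` holomorphic on `nb` and `φ(z₀) = 0`. -/
structure LocalForm (nb : Set ℂ) (z₀ : ℂ) (p φ : ℂ → ℂ) (μ : ℕ) (p₀ : ℂ) : Prop where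
  nb_mem : nb ∈ 𝓝 z₀
  mu_pos : 1 ≤ μ
  p₀_ne : p₀ ≠ 0
  phi_holo : AnalyticOnNhd ℂ φ nb
  phi_zero : φ z₀ = 0
  eq_on : ∀ z ∈ nb, p z = p z₀ - p₀ * (z - z₀) ^ μ * (1 - φ z)

/-- The requirement on the radius `R = R_p` of the circular part of the contour: the closed disk
lies in `nb`, and `Re p` stays below `Re p(z₀)` on the part of each steepest-descent ray in this
disk.  Given a local form, this is so for all sufficiently small `R > 0`. -/
structure IsDescentRadius (nb : Set ℂ) (z₀ : ℂ) (p : ℂ → ℂ) (μ : ℕ) (p₀ : ℂ) (R : ℝ) : Prop where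
  pos : 0 < R
  disk_subset : Metric.closedBall z₀ R ⊆ nb
  descent : ∀ ℓ : ℤ, ∀ r ∈ Ioc 0 R,
    (p (z₀ + r * Complex.exp (Complex.I * (angle p₀ μ ℓ : ℝ)))).re < (p z₀).re

/-- The contour `c` runs from `c 0` to the point `z₁' = c t₁` at distance `R` from `z₀` in the
direction `θ_{k₁}`, then along the circle of radius `R` about `z₀` to the point `z₂' = c t₂` in the
direction `θ_{k₂}`, turning through the angle `2π(k₂ - k₁)/μ`, and finally to `c 1`; on the first
and last parts `Re p < Re p(z₀)`.
The function `ϑ` is the continuous argument of `c t - z₀` along the contour with value `θ_{k₁}` at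
`z₁'`; it records the rotation about `z₀`. -/
structure IsCirclingContour (z₀ : ℂ) (p : ℂ → ℂ) (μ : ℕ) (p₀ : ℂ) (R : ℝ) (k₁ k₂ : ℤ)
    (c : ℝ → ℂ) (ϑ : ℝ → ℝ) (t₁ t₂ : ℝ) : Prop where
  contour : IsContour c
  t₁_nonneg : 0 ≤ t₁
  t₁_le_t₂ : t₁ ≤ t₂
  t₂_le_one : t₂ ≤ 1
  arg_continuous : ContinuousOn ϑ (Icc 0 1)
  arg_spec : ∀ t ∈ Icc (0 : ℝ) 1,
    c t = z₀ + (‖c t - z₀‖ : ℝ) * Complex.exp (Complex.I * (ϑ t : ℝ))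
  arg_t₁ : ϑ t₁ = angle p₀ μ k₁
  arg_t₂ : ϑ t₂ = angle p₀ μ k₂
  circle : ∀ t ∈ Icc t₁ t₂, ‖c t - z₀‖ = R
  descent_in : ∀ t ∈ Icc 0 t₁, (p (c t)).re < (p z₀).re
  descent_out : ∀ t ∈ Icc t₂ 1, (p (c t)).re < (p z₀).re

/-- The branch of `(z - z₀)^{a-1}` at `z = c t` given by the argument `ϑ t` of `c t - z₀`, namely
`|z - z₀|^{a-1} e^{i ϑ(t) (a-1)}`.  With `ϑ` continuous this is the branch continued along `c`. -/
def branchPow (z₀ a : ℂ) (c : ℝ → ℂ) (ϑ : ℝ → ℝ) (t : ℝ) : ℂ :=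
  ((‖c t - z₀‖ : ℝ) : ℂ) ^ (a - 1) * Complex.exp (Complex.I * (ϑ t : ℝ) * (a - 1))

/-- The contour integral of `e^{N p(z)} (z - z₀)^{a-1} q(z)` along `c`. -/
def perronIntegral (z₀ a : ℂ) (p q : ℂ → ℂ) (c : ℝ → ℂ) (ϑ : ℝ → ℝ) (N : ℝ) : ℂ :=
  ∫ t in (0 : ℝ)..1,
    Complex.exp (N * p (c t)) * branchPow z₀ a c ϑ t * q (c t) * deriv c t

/-- The coefficients
`α_s = 1/(μ s!) p₀^{-(s+a)/μ} (d/dz)^s { q(z) (1 - φ(z))^{-(s+a)/μ} } at z = z₀`,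
with principal powers. -/
def alpha (z₀ a : ℂ) (q φ : ℂ → ℂ) (μ : ℕ) (p₀ : ℂ) (s : ℕ) : ℂ :=
  1 / ((μ : ℂ) * (s.factorial : ℂ)) * p₀ ^ (-((s : ℂ) + a) / (μ : ℂ)) *
    iteratedDeriv s (fun z => q z * (1 - φ z) ^ (-((s : ℂ) + a) / (μ : ℂ))) z₀

open Classical in
/-- The factor `Γ((s+a)/μ) (e^{2πi k₂(s+a)/μ} - e^{2πi k₁(s+a)/μ})`, to be read as
`2πi (k₂ - k₁) (-1)^m / m!` when `(s+a)/μ = -m` is a non-positive integer. -/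
def gammaFactor (a : ℂ) (μ : ℕ) (k₁ k₂ : ℤ) (s : ℕ) : ℂ :=
  if h : ∃ m : ℕ, ((s : ℂ) + a) / (μ : ℂ) = -(m : ℂ) then
    2 * Real.pi * Complex.I * ((k₂ : ℂ) - k₁) * (-1) ^ h.choose / (h.choose.factorial : ℂ)
  else
    Complex.Gamma (((s : ℂ) + a) / (μ : ℂ)) *
      (Complex.exp (2 * Real.pi * Complex.I * k₂ * ((s : ℂ) + a) / (μ : ℂ)) -
        Complex.exp (2 * Real.pi * Complex.I * k₁ * ((s : ℂ) + a) / (μ : ℂ)))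

end Perron

end

/-! Put `w = log (z - z₀)`. The differential becomes `exp (N (p z - p z₀)) e^{aw} q(z) dw` with `z =
z₀ + e^w`. It is holomorphic and single-valued on a half-plane `Re w < log R'` with `R' > R`: the
branch of the power is recorded by `Im w`, and `z₀` is moved to `Re w = -∞`. If `F` is a primitive,
the circular part of the contour contributes the difference of `F` between `log R + iθ_{k₂}` and
`log R + iθ_{k₁}` (`integral_circle`). The two outer parts, and the change of `F` along the two rays
from radius `R` to a small radius `ρ`, are exponentially small, because by compactness `Re p` stays
below `Re p z₀` by a fixed gap (`exists_descent_integral_bound`, `exists_radial_bound`).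

At radius `ρ` use `v = log (N p₀ (z - z₀)^μ (1 - φ))`, which is `phaseLog`. Write `q` as a
combination of the functions `(z - z₀)^s (1 - φ)^{(s+a)/μ} κ`, `s < S`, plus a remainder `(z - z₀)^S
t`. The basis is chosen so that the term of index `s` is exactly a constant times `exp (-e^v + βv)
dv` with `β = (s+a)/μ`; its coefficient is found by residues (`expansionCoeff_eq`). A primitive of
this differential has limits at `+∞ + 2πik`, and the difference of two of them is a Hankel loop
integral: it follows from Euler's integral when `Re β > 0`, and from integration by parts for all
other `β` (`hasHankelJump_gammaFactor`). Stopping at radius `ρ` misses the limits by less than any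
power of `N`.

For the remainder the path cannot be contracted to `z₀`, since `Re (S + a)` may be negative. It
follows the rays down to radius `ρ (N₀/N)^{1/μ}` and turns there, where the phase is bounded
(`exists_remainder_bound`). Every bound is linear in the bound for `q`, which gives the uniformity.
-/

namespace Perron

/-! ### Decay of the Hankel integrand and its primitives -/

theorem exists_exp_neg_le_rpow {δ X₀ : ℝ} (hδ : 0 < δ) (hX₀ : 0 < X₀) (σ : ℝ) :
    ∃ C : ℝ, 0 ≤ C ∧ ∀ X : ℝ, X₀ ≤ X → Real.exp (-δ * X) ≤ C * X ^ (-σ) := by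
  have ht := tendsto_rpow_mul_exp_neg_mul_atTop_nhds_zero σ δ hδ
  obtain ⟨X₁, hX₁⟩ := (ht.eventually (ge_mem_nhds zero_lt_one)).exists_forall_of_atTop
  have hcont : ContinuousOn (fun X : ℝ => X ^ σ * Real.exp (-δ * X)) (Icc X₀ X₁) := by
    refine ContinuousOn.mul ?_ (by fun_prop)
    exact fun x hx => (Real.continuousAt_rpow_const x σ
      (Or.inl (hX₀.trans_le hx.1).ne')).continuousWithinAt
  obtain ⟨B, hB⟩ := isCompact_Icc.exists_bound_of_continuousOn hcont
  refine ⟨max B 1, by positivity, fun X hX => ?_⟩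
  have hXpos : 0 < X := hX₀.trans_le hX
  have key : X ^ σ * Real.exp (-δ * X) ≤ max B 1 := by
    rcases le_total X X₁ with h | h
    · exact ((le_abs_self _).trans (hB X ⟨hX, h⟩)).trans (le_max_left _ _)
    · exact (hX₁ X h).trans (le_max_right _ _)
  rw [Real.rpow_neg hXpos.le, ← div_eq_mul_inv, le_div_iff₀ (Real.rpow_pos_of_pos hXpos σ)]
  linarith

theorem exists_exp_neg_exp_le {δ : ℝ} (hδ : 0 < δ) (x₀ σ : ℝ) :
    ∃ C : ℝ, 0 ≤ C ∧ ∀ x : ℝ, x₀ ≤ x → Real.exp (-δ * Real.exp x) ≤ C * Real.exp (-σ * x) := by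
  obtain ⟨C, hC, h⟩ := exists_exp_neg_le_rpow hδ (Real.exp_pos x₀) σ
  refine ⟨C, hC, fun x hx => ?_⟩
  have := h (Real.exp x) (Real.exp_le_exp.2 hx)
  rwa [← Real.exp_mul, mul_comm x] at this

theorem hasDerivAt_comp_vertical {F : ℂ → ℂ} {f : ℂ} {x y : ℝ}
    (h : HasDerivAt F f (x + y * Complex.I)) :
    HasDerivAt (fun t : ℝ => F (x + t * Complex.I)) (f * Complex.I) y := by
  have h1 : HasDerivAt (fun t : ℂ => (x : ℂ) + t * Complex.I) Complex.I (y : ℂ) := by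
    simpa using ((hasDerivAt_id (y : ℂ)).mul_const Complex.I).const_add (x : ℂ)
  exact (h.comp (y : ℂ) h1).comp_ofReal

theorem hasDerivAt_comp_horizontal {F : ℂ → ℂ} {f : ℂ} {x y : ℝ}
    (h : HasDerivAt F f (x + y * Complex.I)) :
    HasDerivAt (fun t : ℝ => F (t + y * Complex.I)) f x := by
  have h1 : HasDerivAt (fun t : ℂ => t + y * Complex.I) 1 (x : ℂ) :=
    (hasDerivAt_id (x : ℂ)).add_const _
  simpa using (h.comp (x : ℂ) h1).comp_ofReal

theorem norm_sub_le_of_vertical {F f : ℂ → ℂ} {x y₁ y₂ A : ℝ}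
    (hF : ∀ y ∈ uIcc y₁ y₂, HasDerivAt F (f (x + y * Complex.I)) (x + y * Complex.I))
    (hA : ∀ y ∈ uIcc y₁ y₂, ‖f (x + y * Complex.I)‖ ≤ A) :
    ‖F (x + y₂ * Complex.I) - F (x + y₁ * Complex.I)‖ ≤ A * |y₂ - y₁| := by
  have := (convex_uIcc y₁ y₂).norm_image_sub_le_of_norm_hasDerivWithin_le
    (f := fun t : ℝ => F (x + t * Complex.I))
    (fun y hy => (hasDerivAt_comp_vertical (hF y hy)).hasDerivWithinAt)
    (fun y hy => by simpa using hA y hy) left_mem_uIcc right_mem_uIcc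
  simpa using this

theorem norm_sub_le_of_horizontal {F f : ℂ → ℂ} {x₁ x₂ y A : ℝ}
    (hF : ∀ x ∈ uIcc x₁ x₂, HasDerivAt F (f (x + y * Complex.I)) (x + y * Complex.I))
    (hA : ∀ x ∈ uIcc x₁ x₂, ‖f (x + y * Complex.I)‖ ≤ A) :
    ‖F (x₂ + y * Complex.I) - F (x₁ + y * Complex.I)‖ ≤ A * |x₂ - x₁| := by
  have := (convex_uIcc x₁ x₂).norm_image_sub_le_of_norm_hasDerivWithin_le
    (f := fun t : ℝ => F (t + y * Complex.I))
    (fun x hx => (hasDerivAt_comp_horizontal (hF x hx)).hasDerivWithinAt)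
    (fun x hx => hA x hx) left_mem_uIcc right_mem_uIcc
  simpa using this

/-- The bound does not involve `b`, so `b` can be sent to infinity in tail estimates. -/
theorem norm_sub_le_of_exp_decay {f f' : ℝ → ℂ} {a b A M : ℝ} (hA : 0 ≤ A) (hM : 0 < M)
    (hab : a ≤ b) (hf : ∀ x ∈ Icc a b, HasDerivAt f (f' x) x)
    (hf' : ∀ x ∈ Icc a b, ‖f' x‖ ≤ A * Real.exp (-M * x)) :
    ‖f b - f a‖ ≤ A / M * Real.exp (-M * a) := by
  have h := image_norm_le_of_norm_deriv_right_le_deriv_boundary (a := a) (b := b)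
    (f := fun x => f x - f a) (f' := f')
    (B := fun x => A / M * Real.exp (-M * a) - A / M * Real.exp (-M * x))
    (B' := fun x => A * Real.exp (-M * x))
    (fun x hx => ((hf x hx).continuousAt.sub continuousAt_const).continuousWithinAt)
    (fun x hx => ((hf x (Ico_subset_Icc_self hx)).sub_const _).hasDerivWithinAt)
    (by simp) (fun x => ?_) (fun x hx => hf' x (Ico_subset_Icc_self hx)) (right_mem_Icc.2 hab)
  · refine h.trans ?_
    have : 0 ≤ A / M * Real.exp (-M * b) := by positivity
    linarith
  · have h1 : HasDerivAt (fun x => Real.exp (-M * x)) (Real.exp (-M * x) * (-M * 1)) x :=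
      ((hasDerivAt_id x).const_mul (-M)).exp
    refine ((h1.const_mul (A / M)).const_sub (A / M * Real.exp (-M * a))).congr_deriv ?_
    field_simp

/-- The integrand of the Hankel-type representation of the Gamma function in the logarithmic
coordinate. -/
noncomputable def hankel (β v : ℂ) : ℂ := Complex.exp (-Complex.exp v + β * v)

theorem exists_primitive_hankel (β : ℂ) : ∃ Θ : ℂ → ℂ, ∀ v, HasDerivAt Θ (hankel β v) v := by
  have hd : Differentiable ℂ (hankel β) := by unfold hankel; fun_prop
  obtain ⟨g, hg⟩ := hd.isExactOn_univ
  exact ⟨g, fun v => hg v (mem_univ v)⟩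

theorem norm_hankel (β : ℂ) (x y : ℝ) :
    ‖hankel β (x + y * Complex.I)‖ =
      Real.exp (-(Real.cos y * Real.exp x) + β.re * x - β.im * y) := by
  rw [hankel, Complex.norm_exp]
  congr 1
  simp [Complex.exp_re]
  ring

theorem hankel_add_two_pi (β v : ℂ) (k : ℤ) :
    hankel β (v + (2 * Real.pi * k : ℝ) * Complex.I) =
      Complex.exp (2 * Real.pi * Complex.I * k * β) * hankel β v := by
  have h : Complex.exp (v + (2 * Real.pi * k : ℝ) * Complex.I) = Complex.exp v := by
    rw [Complex.exp_add, show ((2 * Real.pi * k : ℝ) : ℂ) * Complex.I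
      = k * (2 * Real.pi * Complex.I) by push_cast; ring, Complex.exp_int_mul_two_pi_mul_I, mul_one]
  rw [hankel, hankel, h, ← Complex.exp_add]
  congr 1
  push_cast
  ring

/-- At distance at most `η < π/2` from the line `Im v = 2πk`, `Re e^v ≥ cos η · e^x` with `cos η >
0`. This doubly exponential decay beats `e^{-Mx}` for every real `M`. -/
theorem exists_hankel_bound (β : ℂ) (k : ℤ) {η : ℝ} (hη : η < Real.pi / 2)
    (M x₀ : ℝ) :
    ∃ C : ℝ, 0 ≤ C ∧ ∀ x y : ℝ, x₀ ≤ x → |y - 2 * Real.pi * k| ≤ η →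
      ‖hankel β (x + y * Complex.I)‖ ≤ C * Real.exp (-M * x) := by
  rcases lt_or_ge η 0 with hneg | hη0
  · exact ⟨0, le_rfl, fun x y _ hy => absurd (hneg.trans_le (abs_nonneg _)) (not_lt.2 hy)⟩
  have hcos : 0 < Real.cos η := Real.cos_pos_of_mem_Ioo ⟨by linarith [Real.pi_pos], hη⟩
  obtain ⟨C, hC, h⟩ := exists_exp_neg_exp_le hcos x₀ (M + β.re)
  refine ⟨C * Real.exp (|β.im| * (|2 * Real.pi * k| + η)), by positivity, fun x y hx hy => ?_⟩
  have hcy : Real.cos η ≤ Real.cos y := by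
    have h1 : Real.cos y = Real.cos |y - 2 * Real.pi * k| := by
      rw [Real.cos_abs, show y - 2 * Real.pi * k = y - k * (2 * Real.pi) by ring,
        Real.cos_sub_int_mul_two_pi]
    rw [h1]
    exact Real.cos_le_cos_of_nonneg_of_le_pi (abs_nonneg _) (by linarith [Real.pi_pos]) hy
  have h2 : -(β.im * y) ≤ |β.im| * (|2 * Real.pi * k| + η) := by
    calc -(β.im * y) ≤ |β.im * y| := neg_le_abs _
      _ = |β.im| * |y| := abs_mul _ _
      _ ≤ _ := by
        gcongr
        calc |y| = |2 * Real.pi * k + (y - 2 * Real.pi * k)| := by ring_nf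
          _ ≤ _ := (abs_add_le _ _).trans (by gcongr)
  have h3 : Real.cos η * Real.exp x ≤ Real.cos y * Real.exp x := by gcongr
  rw [norm_hankel]
  calc Real.exp (-(Real.cos y * Real.exp x) + β.re * x - β.im * y)
      ≤ Real.exp (-Real.cos η * Real.exp x + β.re * x + |β.im| * (|2 * Real.pi * k| + η)) := by
        apply Real.exp_le_exp.2; linarith
    _ = Real.exp (-Real.cos η * Real.exp x) * Real.exp (β.re * x)
          * Real.exp (|β.im| * (|2 * Real.pi * k| + η)) := by rw [Real.exp_add, Real.exp_add]
    _ ≤ C * Real.exp (-(M + β.re) * x) * Real.exp (β.re * x)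
          * Real.exp (|β.im| * (|2 * Real.pi * k| + η)) := by gcongr; exact h x hx
    _ = _ := by
        rw [show -M * x = -(M + β.re) * x + β.re * x by ring, Real.exp_add]; ring

theorem exists_tendsto_hankel {β : ℂ} {Θ : ℂ → ℂ} (hΘ : ∀ v, HasDerivAt Θ (hankel β v) v)
    (k : ℤ) :
    ∃ l : ℂ, Tendsto (fun x : ℝ => Θ (x + (2 * Real.pi * k : ℝ) * Complex.I)) atTop (𝓝 l) := by
  obtain ⟨C, hC, h⟩ := exists_hankel_bound β k (η := 0) (by positivity) 1 0
  refine ⟨_, tendsto_limUnder_of_hasDerivAt_of_integrableOn_Ioi (a := 0)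
    (f' := fun x : ℝ => hankel β (x + (2 * Real.pi * k : ℝ) * Complex.I))
    (fun x _ => hasDerivAt_comp_horizontal (hΘ _)) ?_⟩
  refine Integrable.mono' (g := fun x => C * Real.exp (-1 * x)) ?_ ?_ ?_
  · exact (exp_neg_integrableOn_Ioi 0 zero_lt_one).const_mul C
  · refine Continuous.aestronglyMeasurable ?_
    unfold hankel
    fun_prop
  · filter_upwards [ae_restrict_mem measurableSet_Ioi] with x hx
    exact h x _ (le_of_lt hx) (by simp)

/-- Move vertically to the line `Im v = 2πk`, then along it to infinity; the integrand is small on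
both pieces. -/
theorem exists_hankel_tail {β : ℂ} {Θ : ℂ → ℂ} (hΘ : ∀ v, HasDerivAt Θ (hankel β v) v)
    (k : ℤ) {l : ℂ}
    (hl : Tendsto (fun x : ℝ => Θ (x + (2 * Real.pi * k : ℝ) * Complex.I)) atTop (𝓝 l))
    {η M : ℝ} (hη0 : 0 ≤ η) (hη : η < Real.pi / 2) (hM : 0 < M) (x₀ : ℝ) :
    ∃ C : ℝ, 0 ≤ C ∧ ∀ x y : ℝ, x₀ ≤ x → |y - 2 * Real.pi * k| ≤ η →
      ‖l - Θ (x + y * Complex.I)‖ ≤ C * Real.exp (-M * x) := by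
  obtain ⟨C, hC, h⟩ := exists_hankel_bound β k hη M x₀
  refine ⟨C / M + C * η, by positivity, fun x y hx hy => ?_⟩
  have hv : ‖Θ (x + (2 * Real.pi * k : ℝ) * Complex.I) - Θ (x + y * Complex.I)‖ ≤
      C * Real.exp (-M * x) * |2 * Real.pi * k - y| := by
    refine norm_sub_le_of_vertical (fun t _ => hΘ _) fun t ht => h x t hx ?_
    rw [abs_sub_comm] at hy ⊢
    exact (abs_sub_right_of_mem_uIcc ht).trans hy
  have hh : ‖l - Θ (x + (2 * Real.pi * k : ℝ) * Complex.I)‖ ≤ C / M * Real.exp (-M * x) := by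
    refine le_of_tendsto (hl.sub_const _).norm ?_
    filter_upwards [eventually_ge_atTop x] with x' hx'
    refine norm_sub_le_of_exp_decay
      (f := fun x : ℝ => Θ (x + (2 * Real.pi * k : ℝ) * Complex.I)) hC hM hx'
      (fun t _ => hasDerivAt_comp_horizontal (hΘ _)) fun t ht => h t _ (hx.trans ht.1) ?_
    simpa using hη0
  calc ‖l - Θ (x + y * Complex.I)‖ ≤ ‖l - Θ (x + (2 * Real.pi * k : ℝ) * Complex.I)‖ +
        ‖Θ (x + (2 * Real.pi * k : ℝ) * Complex.I) - Θ (x + y * Complex.I)‖ :=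
        norm_sub_le_norm_sub_add_norm_sub _ _ _
    _ ≤ C / M * Real.exp (-M * x) + C * Real.exp (-M * x) * |2 * Real.pi * k - y| :=
        add_le_add hh hv
    _ ≤ C / M * Real.exp (-M * x) + C * Real.exp (-M * x) * η := by
        gcongr; rwa [abs_sub_comm]
    _ = _ := by ring

end Perron

/-! ### Hankel's loop integral for the Gamma function -/

namespace Perron

/-- Translation by `2πik` multiplies `hankel β` by `e^{2πikβ}`, so `Θ(x + 2πik) - e^{2πikβ} Θ(x)` is
constant and equals its limit at `+∞`. -/
theorem hankel_limit_sub {β : ℂ} {Θ : ℂ → ℂ} (hΘ : ∀ v, HasDerivAt Θ (hankel β v) v)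
    (k : ℤ) {l l₀ : ℂ}
    (hl : Tendsto (fun x : ℝ => Θ (x + (2 * Real.pi * k : ℝ) * Complex.I)) atTop (𝓝 l))
    (hl₀ : Tendsto (fun x : ℝ => Θ x) atTop (𝓝 l₀)) (x : ℝ) :
    l - Θ (x + (2 * Real.pi * k : ℝ) * Complex.I) =
      Complex.exp (2 * Real.pi * Complex.I * k * β) * (l₀ - Θ x) := by
  set e := Complex.exp (2 * Real.pi * Complex.I * k * β)
  let D : ℝ → ℂ := fun x => Θ (x + (2 * Real.pi * k : ℝ) * Complex.I) - e * Θ x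
  have hD : ∀ x, HasDerivAt D 0 x := fun x => by
    have h1 : HasDerivAt (fun x : ℝ => Θ (x + (2 * Real.pi * k : ℝ) * Complex.I)) _ x :=
      hasDerivAt_comp_horizontal (hΘ _)
    refine (h1.sub ((hΘ x).comp_ofReal.const_mul e)).congr_deriv ?_
    rw [hankel_add_two_pi, sub_self]
  have hlim : Tendsto D atTop (𝓝 (l - e * l₀)) := hl.sub (hl₀.const_mul e)
  have hconst : D = fun _ => D x := by
    funext t
    exact is_const_of_deriv_eq_zero (fun t => (hD t).differentiableAt) (fun t => (hD t).deriv) t x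
  rw [hconst] at hlim
  have := tendsto_nhds_unique hlim tendsto_const_nhds
  simp only [D] at this
  linear_combination this

/-- The substitution `X = e^x` turns `l₀ - Θ x` into the part of Euler's integral over `X > e^x`. -/
theorem tendsto_hankel_atBot {β : ℂ} (hβ : 0 < β.re) {Θ : ℂ → ℂ}
    (hΘ : ∀ v, HasDerivAt Θ (hankel β v) v) {l₀ : ℂ}
    (hl₀ : Tendsto (fun x : ℝ => Θ x) atTop (𝓝 l₀)) :
    Tendsto (fun x : ℝ => l₀ - Θ x) atBot (𝓝 (Complex.Gamma β)) := by
  let g : ℝ → ℂ := fun X => Complex.exp (-X) * (X : ℂ) ^ (β - 1)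
  have hint : IntegrableOn g (Ioi 0) := by
    have := Complex.GammaIntegral_convergent hβ
    refine this.congr_fun (fun X _ => ?_) measurableSet_Ioi
    simp [g]
  have hval : ∫ X in Ioi 0, g X = Complex.Gamma β := by
    rw [Complex.Gamma_eq_integral hβ, Complex.GammaIntegral]
    simp [g]
  have hexp0 : Tendsto Real.exp atBot (𝓝 0) := Real.tendsto_exp_atBot
  have hcov : AECover (volume.restrict (Ioi (0 : ℝ))) atBot fun x : ℝ => Ioi (Real.exp x) :=
    aecover_Ioi_of_Ioi hexp0
  have ht := hcov.integral_tendsto_of_countably_generated hint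
  rw [hval] at ht
  refine ht.congr fun x => ?_
  have hsub : Ioi (Real.exp x) ⊆ Ioi 0 := Ioi_subset_Ioi (Real.exp_pos x).le
  rw [Measure.restrict_restrict measurableSet_Ioi, inter_eq_left.2 hsub]
  have hd : ∀ X ∈ Ici (Real.exp x), HasDerivAt (fun X : ℝ => Θ (Real.log X : ℝ)) (g X) X := by
    intro X hX
    have hX0 : 0 < X := (Real.exp_pos x).trans_le hX
    have h1 := (hΘ (Real.log X : ℝ)).comp_ofReal
    have h2 : HasDerivAt (fun X : ℝ => Θ (Real.log X : ℝ)) (X⁻¹ • hankel β (Real.log X : ℝ)) X :=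
      h1.scomp X (Real.hasDerivAt_log hX0.ne')
    refine h2.congr_deriv ?_
    have hXC : (X : ℂ) ≠ 0 := by exact_mod_cast hX0.ne'
    simp only [g, hankel]
    rw [Complex.ofReal_log hX0.le, Complex.exp_log hXC, Complex.exp_add,
      Complex.cpow_sub _ _ hXC, Complex.cpow_one, Complex.cpow_def_of_ne_zero hXC,
      Complex.real_smul, mul_comm β]
    push_cast
    field_simp
  have := integral_Ioi_of_hasDerivAt_of_tendsto' hd (hint.mono_set hsub)
    (hl₀.comp Real.tendsto_log_atTop)
  rw [this, Real.log_exp]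

/-- The primitives of `hankel β` increase by `J` from the end at `+∞ + 2πik₁` to the end at
`+∞ + 2πik₂`. -/
def HasHankelJump (β : ℂ) (k₁ k₂ : ℤ) (J : ℂ) : Prop :=
  ∀ (Θ : ℂ → ℂ) (l₁ l₂ : ℂ), (∀ v, HasDerivAt Θ (hankel β v) v) →
    Tendsto (fun x : ℝ => Θ (x + (2 * Real.pi * k₁ : ℝ) * Complex.I)) atTop (𝓝 l₁) →
    Tendsto (fun x : ℝ => Θ (x + (2 * Real.pi * k₂ : ℝ) * Complex.I)) atTop (𝓝 l₂) →
    l₂ - l₁ = J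

/-- The loop comes in along one line to abscissa `x`, crosses vertically, and leaves along the
other. As `x` is arbitrary, it may tend to `-∞`. -/
theorem hankel_jump_eq {β : ℂ} {k₁ k₂ : ℤ} {Θ : ℂ → ℂ} {l₁ l₂ l₀ : ℂ}
    (hΘ : ∀ v, HasDerivAt Θ (hankel β v) v)
    (h₁ : Tendsto (fun x : ℝ => Θ (x + (2 * Real.pi * k₁ : ℝ) * Complex.I)) atTop (𝓝 l₁))
    (h₂ : Tendsto (fun x : ℝ => Θ (x + (2 * Real.pi * k₂ : ℝ) * Complex.I)) atTop (𝓝 l₂))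
    (h₀ : Tendsto (fun x : ℝ => Θ x) atTop (𝓝 l₀)) (x : ℝ) :
    l₂ - l₁ = (l₀ - Θ x) * (Complex.exp (2 * Real.pi * Complex.I * k₂ * β) -
      Complex.exp (2 * Real.pi * Complex.I * k₁ * β)) +
      (Θ (x + (2 * Real.pi * k₂ : ℝ) * Complex.I) - Θ (x + (2 * Real.pi * k₁ : ℝ) * Complex.I)) := by
  linear_combination hankel_limit_sub hΘ k₂ h₂ h₀ x - hankel_limit_sub hΘ k₁ h₁ h₀ x

theorem exists_tendsto_hankel_real {β : ℂ} {Θ : ℂ → ℂ}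
    (hΘ : ∀ v, HasDerivAt Θ (hankel β v) v) :
    ∃ l : ℂ, Tendsto (fun x : ℝ => Θ x) atTop (𝓝 l) := by
  obtain ⟨l, hl⟩ := exists_tendsto_hankel hΘ 0
  exact ⟨l, by simpa using hl⟩

/-- As `x → -∞` the vertical crossing vanishes like `e^{Re β · x}`, and the horizontal parts give
Euler's integral. -/
theorem hasHankelJump_of_re_pos {β : ℂ} (hβ : 0 < β.re) (k₁ k₂ : ℤ) :
    HasHankelJump β k₁ k₂ (Complex.Gamma β * (Complex.exp (2 * Real.pi * Complex.I * k₂ * β) -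
      Complex.exp (2 * Real.pi * Complex.I * k₁ * β))) := by
  intro Θ l₁ l₂ hΘ h₁ h₂
  obtain ⟨l₀, h₀⟩ := exists_tendsto_hankel_real hΘ
  set y₁ : ℝ := 2 * Real.pi * k₁
  set y₂ : ℝ := 2 * Real.pi * k₂
  obtain ⟨B, hB⟩ := (isCompact_uIcc (a := y₁) (b := y₂)).exists_bound_of_continuousOn
    (f := fun y : ℝ => β.im * y) (by fun_prop)
  have hvert : Tendsto (fun x : ℝ => Θ (x + y₂ * Complex.I) - Θ (x + y₁ * Complex.I))
      atBot (𝓝 0) := by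
    refine squeeze_zero_norm (a := fun x => Real.exp (Real.exp x + β.re * x + B) * |y₂ - y₁|)
      (fun x => ?_) ?_
    · refine norm_sub_le_of_vertical (fun y _ => hΘ _) fun y hy => ?_
      rw [norm_hankel]
      apply Real.exp_le_exp.2
      have h1 : -(Real.cos y * Real.exp x) ≤ Real.exp x := by
        nlinarith [Real.neg_one_le_cos y, Real.exp_pos x]
      have h2 : -(β.im * y) ≤ B := (neg_le_abs _).trans (hB y hy)
      linarith
    · have h3 : Tendsto (fun x : ℝ => β.re * x + (Real.exp x + B)) atBot atBot :=
        (tendsto_id.const_mul_atBot hβ).atBot_add (Real.tendsto_exp_atBot.add_const B)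
      have h4 := (Real.tendsto_exp_atBot.comp h3).mul_const |y₂ - y₁|
      rw [zero_mul] at h4
      refine h4.congr fun x => ?_
      simp only [Function.comp]
      ring_nf
  have hlim := ((tendsto_hankel_atBot hβ hΘ h₀).mul_const
    (Complex.exp (2 * Real.pi * Complex.I * k₂ * β) -
      Complex.exp (2 * Real.pi * Complex.I * k₁ * β))).add hvert
  rw [add_zero] at hlim
  refine tendsto_nhds_unique (tendsto_const_nhds.congr fun x => ?_) hlim
  exact hankel_jump_eq hΘ h₁ h₂ h₀ x

/-- For `β = 0` the horizontal parts cancel. On the crossing the integrand `exp (-e^v)` tends to `1`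
as `x → -∞`, so only the length of the crossing remains. -/
theorem hasHankelJump_zero (k₁ k₂ : ℤ) :
    HasHankelJump 0 k₁ k₂ (2 * Real.pi * Complex.I * (k₂ - k₁)) := by
  intro Θ l₁ l₂ hΘ h₁ h₂
  obtain ⟨l₀, h₀⟩ := exists_tendsto_hankel_real hΘ
  have hj := hankel_jump_eq hΘ h₁ h₂ h₀
  simp only [mul_zero, sub_self, zero_add] at hj
  set y₁ : ℝ := 2 * Real.pi * k₁ with hy₁
  set y₂ : ℝ := 2 * Real.pi * k₂ with hy₂
  have hvert : Tendsto (fun x : ℝ => (Θ (x + y₂ * Complex.I) - (x + y₂ * Complex.I))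
      - (Θ (x + y₁ * Complex.I) - (x + y₁ * Complex.I))) atBot (𝓝 0) := by
    refine squeeze_zero_norm' (a := fun x => 2 * Real.exp x * |y₂ - y₁|) ?_ ?_
    · filter_upwards [eventually_le_atBot 0] with x hx
      refine norm_sub_le_of_vertical (F := fun v => Θ v - v) (f := fun v => hankel 0 v - 1)
        (fun y _ => (hΘ _).sub (hasDerivAt_id _)) fun y hy => ?_
      have hn : ‖-Complex.exp (x + y * Complex.I)‖ = Real.exp x := by
        rw [norm_neg, Complex.norm_exp]; simp
      have := Complex.norm_exp_sub_one_le (x := -Complex.exp (x + y * Complex.I))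
        (by rw [hn]; exact Real.exp_le_one_iff.2 hx)
      rw [hn] at this
      simpa [hankel] using this
    · have := (Real.tendsto_exp_atBot.const_mul 2).mul_const |y₂ - y₁|
      simpa using this
  have hc : Tendsto (fun _ : ℝ => l₂ - l₁ - (y₂ - y₁) * Complex.I) (atBot : Filter ℝ) (𝓝 0) :=
    hvert.congr fun x => by rw [hj x]; ring
  have h0 := tendsto_nhds_unique tendsto_const_nhds hc
  rw [hy₁, hy₂] at h0
  push_cast at h0
  linear_combination h0

/-- Integration by parts: `β Θ - hankel β` is a primitive of `hankel (β + 1)`, and the boundary term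
vanishes at both ends. -/
theorem HasHankelJump.of_add_one {β : ℂ} (hβ : β ≠ 0) {k₁ k₂ : ℤ} {J : ℂ}
    (h : HasHankelJump (β + 1) k₁ k₂ J) : HasHankelJump β k₁ k₂ (J / β) := by
  intro Θ l₁ l₂ hΘ h₁ h₂
  have hd : ∀ v, HasDerivAt (fun v => β * Θ v - hankel β v) (hankel (β + 1) v) v := by
    intro v
    have h1 : HasDerivAt (hankel β) (hankel β v * (-Complex.exp v + β * 1)) v :=
      ((Complex.hasDerivAt_exp v).neg.add ((hasDerivAt_id v).const_mul β)).cexp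
    refine (((hΘ v).const_mul β).sub h1).congr_deriv ?_
    have : hankel (β + 1) v = hankel β v * Complex.exp v := by
      rw [hankel, hankel, ← Complex.exp_add]; ring_nf
    rw [this]; ring
  have h0 : ∀ k : ℤ, Tendsto (fun x : ℝ => hankel β (x + (2 * Real.pi * k : ℝ) * Complex.I))
      atTop (𝓝 0) := by
    intro k
    obtain ⟨C, hC, hb⟩ := exists_hankel_bound β k (η := 0) (by positivity) 1 0
    refine squeeze_zero_norm' (a := fun x => C * Real.exp (-1 * x)) ?_ ?_
    · filter_upwards [eventually_ge_atTop 0] with x hx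
      exact hb x _ hx (by simp)
    · have := (Real.tendsto_exp_neg_atTop_nhds_zero).const_mul C
      simpa using this
  have hJ := h _ _ _ hd ((h₁.const_mul β).sub (h0 k₁)) ((h₂.const_mul β).sub (h0 k₂))
  rw [← hJ]
  field_simp
  ring

/-- Descent from `Re β > 0`: the exponentials have period `1` in `β`, and division by `β` is the
functional equation of Gamma. -/
theorem hasHankelJump_of_ne {β : ℂ} (hβ : ∀ m : ℕ, β ≠ -m) (k₁ k₂ : ℤ) :
    HasHankelJump β k₁ k₂ (Complex.Gamma β * (Complex.exp (2 * Real.pi * Complex.I * k₂ * β) -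
      Complex.exp (2 * Real.pi * Complex.I * k₁ * β))) := by
  obtain ⟨n, hn⟩ := exists_nat_gt (-β.re)
  induction n generalizing β with
  | zero => exact hasHankelJump_of_re_pos (by simpa using hn) k₁ k₂
  | succ n ih =>
    have hβ0 : β ≠ 0 := by simpa using hβ 0
    have h1 := ih (β := β + 1)
      (fun m hm => hβ (m + 1) (by push_cast; linear_combination hm))
      (by push_cast at hn; simp only [Complex.add_re, Complex.one_re]; linarith)
    have hper : ∀ k : ℤ, Complex.exp (2 * Real.pi * Complex.I * k * (β + 1)) =
        Complex.exp (2 * Real.pi * Complex.I * k * β) := fun k => by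
      rw [mul_add, Complex.exp_add, mul_one, mul_comm (2 * (Real.pi : ℂ) * Complex.I) (k : ℂ),
        Complex.exp_int_mul_two_pi_mul_I, mul_one]
    rw [hper, hper, Complex.Gamma_add_one β hβ0] at h1
    convert h1.of_add_one hβ0 using 1
    field_simp

theorem hasHankelJump_neg_nat (m : ℕ) (k₁ k₂ : ℤ) :
    HasHankelJump (-m) k₁ k₂
      (2 * Real.pi * Complex.I * (k₂ - k₁) * (-1) ^ m / (m.factorial : ℂ)) := by
  induction m with
  | zero => simpa using hasHankelJump_zero k₁ k₂
  | succ m ih =>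
    have hne : (-((m + 1 : ℕ) : ℂ)) ≠ 0 := neg_ne_zero.2 (Nat.cast_ne_zero.2 m.succ_ne_zero)
    have h1 := HasHankelJump.of_add_one hne (k₁ := k₁) (k₂ := k₂)
      (J := 2 * Real.pi * Complex.I * (k₂ - k₁) * (-1) ^ m / (m.factorial : ℂ))
      (by convert ih using 1; push_cast; ring)
    convert h1 using 1
    have hf : (m.factorial : ℂ) ≠ 0 := Nat.cast_ne_zero.2 m.factorial_ne_zero
    have hm : (m : ℂ) + 1 ≠ 0 := by exact_mod_cast m.succ_ne_zero
    rw [Nat.factorial_succ]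
    push_cast
    field_simp
    ring

theorem hasHankelJump_gammaFactor (a : ℂ) (μ : ℕ) (k₁ k₂ : ℤ) (s : ℕ) :
    HasHankelJump (((s : ℂ) + a) / (μ : ℂ)) k₁ k₂ (gammaFactor a μ k₁ k₂ s) := by
  unfold gammaFactor
  split_ifs with h
  · have := hasHankelJump_neg_nat h.choose k₁ k₂
    rwa [← h.choose_spec] at this
  · push Not at h
    have := hasHankelJump_of_ne h k₁ k₂
    simpa only [mul_div_assoc] using this

end Perron

/-! ### Expansion of `q` adapted to the coordinate `(z - z₀)(1 - φ)^{1/μ}` -/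

namespace Perron

/-- `φ` is holomorphic on the disk of radius `r` about `z₀`, vanishes at `z₀`, and stays below
`1 / 2` in modulus. -/
structure SmallOn (z₀ : ℂ) (φ : ℂ → ℂ) (r : ℝ) : Prop where
  diff : DifferentiableOn ℂ φ (Metric.ball z₀ r)
  zero : φ z₀ = 0
  lt : ∀ z ∈ Metric.ball z₀ r, ‖φ z‖ < 1 / 2

/-- The logarithmic derivative with respect to `log (z - z₀)` of the coordinate
`(z - z₀) (1 - φ z) ^ (1 / μ)`. -/
noncomputable def kappa (z₀ : ℂ) (φ : ℂ → ℂ) (μ : ℕ) (z : ℂ) : ℂ :=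
  1 - (z - z₀) * deriv φ z / (μ * (1 - φ z))

/-- The power `(1 - φ) ^ ((s + a) / μ)` times `kappa`: up to a power of `z - z₀`, the pull-back of
the `s`-th monomial differential in the coordinate `(z - z₀) (1 - φ z) ^ (1 / μ)`. -/
noncomputable def monomialFactor (z₀ a : ℂ) (φ : ℂ → ℂ) (μ s : ℕ) (z : ℂ) : ℂ :=
  (1 - φ z) ^ (((s : ℂ) + a) / (μ : ℂ)) * kappa z₀ φ μ z

/-- The `s`-th coefficient of `q` in the expansion in the functions `monomialFactor`. -/
noncomputable def expansionCoeff (z₀ a : ℂ) (φ : ℂ → ℂ) (μ s : ℕ) (q : ℂ → ℂ) : ℂ :=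
  iteratedDeriv s (fun z => q z * (1 - φ z) ^ (-((s : ℂ) + a) / (μ : ℂ))) z₀ / (s.factorial : ℂ)

variable {z₀ a : ℂ} {φ : ℂ → ℂ} {μ : ℕ} {r ρ : ℝ}

theorem SmallOn.re_pos (h : SmallOn z₀ φ r) {z : ℂ} (hz : z ∈ Metric.ball z₀ r) :
    1 / 2 < (1 - φ z).re := by
  have h1 := (Complex.abs_re_le_norm (φ z)).trans_lt (h.lt z hz)
  have h2 := (abs_lt.1 h1).2
  simp only [Complex.sub_re, Complex.one_re]
  linarith

theorem SmallOn.mem_slitPlane (h : SmallOn z₀ φ r) {z : ℂ} (hz : z ∈ Metric.ball z₀ r) :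
    1 - φ z ∈ Complex.slitPlane :=
  Or.inl (by linarith [h.re_pos hz])

theorem SmallOn.ne_zero (h : SmallOn z₀ φ r) {z : ℂ} (hz : z ∈ Metric.ball z₀ r) :
    1 - φ z ≠ 0 :=
  Complex.slitPlane_ne_zero (h.mem_slitPlane hz)

theorem SmallOn.differentiableAt (h : SmallOn z₀ φ r) {z : ℂ} (hz : z ∈ Metric.ball z₀ r) :
    DifferentiableAt ℂ φ z :=
  h.diff.differentiableAt (Metric.isOpen_ball.mem_nhds hz)

theorem SmallOn.differentiableOn_cpow (h : SmallOn z₀ φ r) (β : ℂ) :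
    DifferentiableOn ℂ (fun z => (1 - φ z) ^ β) (Metric.ball z₀ r) := fun _ hz =>
  (((differentiableAt_const 1).sub (h.differentiableAt hz)).cpow_const
    (h.mem_slitPlane hz)).differentiableWithinAt

theorem SmallOn.differentiableOn_kappa (h : SmallOn z₀ φ r) (hμ : 1 ≤ μ) :
    DifferentiableOn ℂ (kappa z₀ φ μ) (Metric.ball z₀ r) := by
  have hμ0 : (μ : ℂ) ≠ 0 := Nat.cast_ne_zero.2 (by omega)
  have hd : DifferentiableOn ℂ (deriv φ) (Metric.ball z₀ r) := h.diff.deriv Metric.isOpen_ball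
  unfold kappa
  refine (differentiableOn_const 1).sub (DifferentiableOn.div (by fun_prop)
    ((differentiableOn_const _).mul ((differentiableOn_const 1).sub h.diff)) fun z hz => ?_)
  exact mul_ne_zero hμ0 (h.ne_zero hz)

theorem SmallOn.differentiableOn_monomialFactor (h : SmallOn z₀ φ r) (hμ : 1 ≤ μ) (s : ℕ) :
    DifferentiableOn ℂ (monomialFactor z₀ a φ μ s) (Metric.ball z₀ r) :=
  (h.differentiableOn_cpow _).mul (h.differentiableOn_kappa hμ)

theorem SmallOn.monomialFactor_center (h : SmallOn z₀ φ r) (s : ℕ) :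
    monomialFactor z₀ a φ μ s z₀ = 1 := by
  simp [monomialFactor, kappa, h.zero]

/-- With `ζ = (z - z₀)(1 - φ)^{1/μ}` the function is `ζ^{-(n+1)}`, and the logarithmic derivative of
`ζ` is `κ / (z - z₀)`. This makes the polar terms of the residue computation exact. -/
theorem SmallOn.hasDerivAt_pow (h : SmallOn z₀ φ r) (hμ : 1 ≤ μ) (n : ℕ) {z : ℂ}
    (hz : z ∈ Metric.ball z₀ r) (hne : z ≠ z₀) :
    HasDerivAt (fun z => ((z - z₀) ^ (n + 1))⁻¹ * (1 - φ z) ^ (-((n : ℂ) + 1) / (μ : ℂ)))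
      (-((n : ℂ) + 1) * (((z - z₀) ^ (n + 2))⁻¹ * (1 - φ z) ^ (-((n : ℂ) + 1) / (μ : ℂ))
        * kappa z₀ φ μ z)) z := by
  have hμ0 : (μ : ℂ) ≠ 0 := Nat.cast_ne_zero.2 (by omega)
  have hz0 : z - z₀ ≠ 0 := sub_ne_zero.2 hne
  have h1 : HasDerivAt (fun z => ((z - z₀) ^ (n + 1))⁻¹)
      (-((n + 1 : ℕ) * (z - z₀) ^ n * 1) / ((z - z₀) ^ (n + 1)) ^ 2) z :=
    (((hasDerivAt_id z).sub_const z₀).pow (n + 1)).inv (pow_ne_zero _ hz0)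
  have h2 : HasDerivAt (fun z => (1 - φ z) ^ (-((n : ℂ) + 1) / (μ : ℂ))) _ z :=
    ((h.differentiableAt hz).hasDerivAt.const_sub 1).cpow_const (h.mem_slitPlane hz)
  refine (h1.mul h2).congr_deriv ?_
  have h3 := h.ne_zero hz
  rw [Complex.cpow_sub _ _ h3, Complex.cpow_one, kappa]
  push_cast
  field_simp
  ring

/-- Lagrange inversion without inverting the coordinate. Multiply by `(z - z₀)^{-(S+1)} (1 -
φ)^{-(S+a)/μ}` and integrate over a circle: Cauchy's formula gives `expansionCoeff` on the left and
`t z₀` from the last term, while the terms with `s < S` are exact differentials. -/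
theorem SmallOn.expansionCoeff_eq (h : SmallOn z₀ φ r) (hμ : 1 ≤ μ) (hr : 0 < r)
    {q t : ℂ → ℂ} {S : ℕ} {d : ℕ → ℂ} (hq : DifferentiableOn ℂ q (Metric.ball z₀ r))
    (ht : DifferentiableOn ℂ t (Metric.ball z₀ r))
    (heq : ∀ z ∈ Metric.ball z₀ r, q z =
      ∑ s ∈ Finset.range S, d s * (z - z₀) ^ s * monomialFactor z₀ a φ μ s z
        + (z - z₀) ^ S * t z) :
    expansionCoeff z₀ a φ μ S q = t z₀ := by
  set β : ℂ := -((S : ℂ) + a) / (μ : ℂ) with hβ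
  have hρ : 0 < r / 2 := by positivity
  have hsub : Metric.closedBall z₀ (r / 2) ⊆ Metric.ball z₀ r :=
    Metric.closedBall_subset_ball (by linarith)
  have hssub : Metric.sphere z₀ (r / 2) ⊆ Metric.ball z₀ r :=
    Metric.sphere_subset_closedBall.trans hsub
  have hne : ∀ z ∈ Metric.sphere z₀ (r / 2), z ≠ z₀ := fun z hz => Metric.ne_of_mem_sphere hz hρ.ne'
  have hQ := ((hq.mul (h.differentiableOn_cpow β)).mono hsub)
    |>.circleIntegral_one_div_sub_center_pow_smul hρ S
  have hT := ((ht.mul (h.differentiableOn_cpow β)).mono hsub)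
    |>.circleIntegral_one_div_sub_center_pow_smul hρ 0
  let A : ℂ → ℂ := fun z => ∑ s ∈ Finset.range S, d s *
    (((z - z₀) ^ (S - s + 1))⁻¹ * (1 - φ z) ^ (-((S - s : ℕ) : ℂ) / (μ : ℂ)) * kappa z₀ φ μ z)
  -- Each summand is the derivative of a multiple of `ζ^{-(S-s)}` with `S - s ≥ 1`.
  have hA : ∮ z in C(z₀, r / 2), A z = 0 := by
    refine circleIntegral.integral_eq_zero_of_hasDerivWithinAt hρ.le
      (f := fun z => ∑ s ∈ Finset.range S, d s * (-1 / ((S - s : ℕ) : ℂ)) *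
        (((z - z₀) ^ (S - s))⁻¹ * (1 - φ z) ^ (-((S - s : ℕ) : ℂ) / (μ : ℂ)))) fun z hz => ?_
    refine (HasDerivAt.fun_sum fun s hs => ?_).hasDerivWithinAt
    obtain ⟨n, hn⟩ : ∃ n, S - s = n + 1 :=
      ⟨S - s - 1, by have := Finset.mem_range.1 hs; omega⟩
    rw [hn]
    have := (h.hasDerivAt_pow hμ n (hssub hz) (hne z hz)).const_mul
      (d s * (-1 / ((n + 1 : ℕ) : ℂ)))
    have hn0 : (n : ℂ) + 1 ≠ 0 := by exact_mod_cast n.succ_ne_zero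
    push_cast at this ⊢
    refine this.congr_deriv ?_
    field_simp
  have hcongr : ∀ z ∈ Metric.sphere z₀ (r / 2),
      (1 / (z - z₀) ^ (S + 1)) • (q z * (1 - φ z) ^ β) =
        A z + (1 / (z - z₀) ^ (0 + 1)) • (t z * (1 - φ z) ^ β) := by
    intro z hz
    have hz0 : z - z₀ ≠ 0 := sub_ne_zero.2 (hne z hz)
    have h3 := h.ne_zero (hssub hz)
    have hμ0 : (μ : ℂ) ≠ 0 := Nat.cast_ne_zero.2 (by omega)
    rw [heq z (hssub hz), add_mul, smul_add, Finset.sum_mul, Finset.smul_sum]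
    congr 1
    · refine Finset.sum_congr rfl fun s hs => ?_
      have hsS : s ≤ S := (Finset.mem_range.1 hs).le
      have hexp : (1 - φ z) ^ (-((S - s : ℕ) : ℂ) / (μ : ℂ)) =
          (1 - φ z) ^ (((s : ℂ) + a) / (μ : ℂ)) * (1 - φ z) ^ β := by
        rw [← Complex.cpow_add _ _ h3, hβ]
        congr 1
        push_cast [hsS]
        ring
      have hpow : (z - z₀) ^ (S + 1) = (z - z₀) ^ s * (z - z₀) ^ (S - s + 1) := by
        rw [← pow_add]; congr 1; omega
      rw [hexp, hpow, smul_eq_mul, monomialFactor]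
      field_simp
    · rw [smul_eq_mul, smul_eq_mul]
      field_simp
      ring
  have hAint : CircleIntegrable A z₀ (r / 2) := by
    refine ContinuousOn.circleIntegrable hρ.le ?_
    refine continuousOn_finsetSum _ fun s _ => continuousOn_const.mul ?_
    refine ContinuousOn.mul (ContinuousOn.mul (ContinuousOn.inv₀ (by fun_prop) fun z hz =>
      pow_ne_zero _ (sub_ne_zero.2 (hne z hz))) ?_) ?_
    · exact (h.differentiableOn_cpow _).continuousOn.mono hssub
    · exact (h.differentiableOn_kappa hμ).continuousOn.mono hssub
  have hTint : CircleIntegrable (fun z => (1 / (z - z₀) ^ (0 + 1)) • (t z * (1 - φ z) ^ β))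
      z₀ (r / 2) := by
    refine ContinuousOn.circleIntegrable hρ.le ?_
    refine ContinuousOn.smul (ContinuousOn.div continuousOn_const (by fun_prop) fun z hz =>
      pow_ne_zero _ (sub_ne_zero.2 (hne z hz))) ?_
    exact (ht.mul (h.differentiableOn_cpow β)).continuousOn.mono hssub
  have hmain := circleIntegral.integral_congr hρ.le hcongr
  rw [circleIntegral.integral_add hAint hTint, hA, zero_add] at hmain
  simp only [Pi.mul_apply] at hQ hT
  have hfun : ∀ f : ℂ → ℂ, (f * fun z => (1 - φ z) ^ β) = fun z => f z * (1 - φ z) ^ β :=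
    fun f => rfl
  rw [hQ, hT, hfun, hfun] at hmain
  have h2pi : (2 * (Real.pi : ℂ) * Complex.I) ≠ 0 := Complex.two_pi_I_ne_zero
  have hfin : (2 * (Real.pi : ℂ) * Complex.I) * expansionCoeff z₀ a φ μ S q =
      (2 * (Real.pi : ℂ) * Complex.I) * t z₀ := by
    simp only [smul_eq_mul, iteratedDeriv_zero, Nat.factorial_zero, Nat.cast_one, div_one,
      h.zero, sub_zero, Complex.one_cpow, mul_one] at hmain
    rw [← hmain, expansionCoeff]
    ring
  exact mul_left_cancel₀ h2pi hfin

/-- Since `monomialFactor` is `1` at `z₀`, subtracting `t z₀` times it creates a zero there, and the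
quotient by `z - z₀` is again holomorphic. -/
theorem SmallOn.exists_expansion (h : SmallOn z₀ φ r) (hμ : 1 ≤ μ) (hr : 0 < r) (a : ℂ)
    {q : ℂ → ℂ} (hq : DifferentiableOn ℂ q (Metric.ball z₀ r)) (S : ℕ) :
    ∃ t : ℂ → ℂ, DifferentiableOn ℂ t (Metric.ball z₀ r) ∧ ∀ z ∈ Metric.ball z₀ r, q z =
      ∑ s ∈ Finset.range S, expansionCoeff z₀ a φ μ s q * (z - z₀) ^ s *
        monomialFactor z₀ a φ μ s z + (z - z₀) ^ S * t z := by
  induction S with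
  | zero => exact ⟨q, hq, fun z _ => by simp⟩
  | succ S ih =>
    obtain ⟨t, ht, heq⟩ := ih
    have hc := h.expansionCoeff_eq hμ hr hq ht heq
    let u : ℂ → ℂ := fun z => t z - t z₀ * monomialFactor z₀ a φ μ S z
    have hu : DifferentiableOn ℂ u (Metric.ball z₀ r) :=
      ht.sub ((differentiableOn_const _).mul (h.differentiableOn_monomialFactor hμ S))
    have hu0 : u z₀ = 0 := by simp [u, h.monomialFactor_center]
    refine ⟨dslope u z₀, (Complex.differentiableOn_dslope (Metric.ball_mem_nhds z₀ hr)).2 hu,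
      fun z hz => ?_⟩
    have hds : (z - z₀) * dslope u z₀ z = u z := by
      have := sub_smul_dslope u z₀ z
      rwa [hu0, sub_zero, smul_eq_mul] at this
    rw [heq z hz, Finset.sum_range_succ, pow_succ, mul_assoc ((z - z₀) ^ S) (z - z₀), hds, hc]
    simp only [u]
    ring

theorem SmallOn.exists_expansionCoeff_bound (h : SmallOn z₀ φ r) (hr : 0 < r) (a : ℂ) (μ s : ℕ) :
    ∃ C : ℝ, 0 ≤ C ∧ ∀ (q : ℂ → ℂ) (K : ℝ), DifferentiableOn ℂ q (Metric.ball z₀ r) →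
      (∀ z ∈ Metric.ball z₀ r, ‖q z‖ ≤ K) → ‖expansionCoeff z₀ a φ μ s q‖ ≤ C * K := by
  set β : ℂ := -((s : ℂ) + a) / (μ : ℂ) with hβ
  have hρ : 0 < r / 2 := by positivity
  have hsub : Metric.closedBall z₀ (r / 2) ⊆ Metric.ball z₀ r :=
    Metric.closedBall_subset_ball (by linarith)
  obtain ⟨M, hM⟩ := (isCompact_closedBall z₀ (r / 2)).exists_bound_of_continuousOn
    ((h.differentiableOn_cpow β).continuousOn.mono hsub)
  have hM0 : 0 ≤ M := (norm_nonneg _).trans (hM z₀ (Metric.mem_closedBall_self hρ.le))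
  refine ⟨M / (r / 2) ^ s, by positivity, fun q K hq hK => ?_⟩
  have hK0 : 0 ≤ K := (norm_nonneg _).trans (hK z₀ (Metric.mem_ball_self hr))
  have hd : DiffContOnCl ℂ (fun z => q z * (1 - φ z) ^ β) (Metric.ball z₀ (r / 2)) :=
    ((hq.mul (h.differentiableOn_cpow β)).mono
      (Metric.closure_ball_subset_closedBall.trans hsub)).diffContOnCl
  have := Complex.norm_iteratedDeriv_le_of_forall_mem_sphere_norm_le s hρ hd (C := K * M)
    fun z hz => by
      have hz' := Metric.sphere_subset_closedBall hz
      rw [norm_mul]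
      exact mul_le_mul (hK z (hsub hz')) (hM z hz') (norm_nonneg _) hK0
  have hf : (0 : ℝ) < s.factorial := by exact_mod_cast s.factorial_pos
  rw [expansionCoeff, norm_div, Complex.norm_natCast, div_le_iff₀ hf]
  calc _ ≤ s.factorial * (K * M) / (r / 2) ^ s := this
    _ = _ := by ring

/-- On the circle of radius `ρ` one can divide by `(z - z₀)^S`; the maximum principle carries the
bound for `t` inside. -/
theorem SmallOn.exists_bounded_expansion (h : SmallOn z₀ φ r) (hμ : 1 ≤ μ) (hρ : 0 < ρ)
    (hρr : ρ < r) (a : ℂ) (S : ℕ) :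
    ∃ C : ℝ, 0 ≤ C ∧ ∀ (q : ℂ → ℂ) (K : ℝ), DifferentiableOn ℂ q (Metric.ball z₀ r) →
      (∀ z ∈ Metric.ball z₀ r, ‖q z‖ ≤ K) →
      ∃ t : ℂ → ℂ, DifferentiableOn ℂ t (Metric.ball z₀ r) ∧
        (∀ z ∈ Metric.ball z₀ r, q z =
          ∑ s ∈ Finset.range S, expansionCoeff z₀ a φ μ s q * (z - z₀) ^ s *
            monomialFactor z₀ a φ μ s z + (z - z₀) ^ S * t z) ∧
        ∀ z ∈ Metric.closedBall z₀ ρ, ‖t z‖ ≤ C * K := by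
  have hr : 0 < r := hρ.trans hρr
  have hsub : Metric.closedBall z₀ ρ ⊆ Metric.ball z₀ r := Metric.closedBall_subset_ball hρr
  choose B hB0 hB using h.exists_expansionCoeff_bound hr a μ
  have hg : ∀ s, ∃ M : ℝ, ∀ z ∈ Metric.closedBall z₀ ρ, ‖monomialFactor z₀ a φ μ s z‖ ≤ M :=
    fun s => (isCompact_closedBall z₀ ρ).exists_bound_of_continuousOn
      ((h.differentiableOn_monomialFactor hμ s).continuousOn.mono hsub)
  choose M hM using hg
  have hM0 : ∀ s, 0 ≤ M s := fun s =>
    (norm_nonneg _).trans (hM s z₀ (Metric.mem_closedBall_self hρ.le))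
  refine ⟨(1 + ∑ s ∈ Finset.range S, B s * ρ ^ s * M s) / ρ ^ S,
    div_nonneg (add_nonneg zero_le_one (Finset.sum_nonneg fun s _ =>
      mul_nonneg (mul_nonneg (hB0 s) (by positivity)) (hM0 s))) (by positivity),
    fun q K hq hK => ?_⟩
  obtain ⟨t, ht, heq⟩ := h.exists_expansion hμ hr a hq S
  refine ⟨t, ht, heq, fun z hz => ?_⟩
  refine Complex.norm_le_of_forall_mem_frontier_norm_le (U := Metric.ball z₀ ρ)
    Metric.isBounded_ball
    ((ht.mono (Metric.closure_ball_subset_closedBall.trans hsub)).diffContOnCl) ?_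
    (by rwa [closure_ball z₀ hρ.ne'])
  intro w hw
  rw [frontier_ball z₀ hρ.ne'] at hw
  have hwc := Metric.sphere_subset_closedBall hw
  have hwn : ‖w - z₀‖ = ρ := mem_sphere_iff_norm.1 hw
  have h1 : (w - z₀) ^ S * t w = q w - ∑ s ∈ Finset.range S,
      expansionCoeff z₀ a φ μ s q * (w - z₀) ^ s * monomialFactor z₀ a φ μ s w := by
    rw [heq w (hsub hwc)]; ring
  have h2 : ρ ^ S * ‖t w‖ ≤ K + ∑ s ∈ Finset.range S, B s * K * ρ ^ s * M s := by
    rw [← hwn, ← norm_pow, ← norm_mul, h1]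
    refine (norm_sub_le _ _).trans (add_le_add (hK w (hsub hwc)) ?_)
    refine (norm_sum_le _ _).trans (Finset.sum_le_sum fun s _ => ?_)
    rw [norm_mul, norm_mul, norm_pow, hwn]
    have := hB s q K hq hK
    exact mul_le_mul (mul_le_mul_of_nonneg_right this (by positivity)) (hM s w hwc)
      (norm_nonneg _) (mul_nonneg ((norm_nonneg _).trans this) (by positivity))
  rw [div_mul_eq_mul_div, le_div_iff₀ (by positivity), mul_comm]
  refine h2.trans (le_of_eq ?_)
  rw [add_mul, one_mul, Finset.sum_mul]
  congr 1
  exact Finset.sum_congr rfl fun s _ => by ring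

end Perron

/-! ### Local analysis: exact monomials and the remainder -/

namespace Perron

/-- The exponential `exp (-N p₀ (z - z₀) ^ μ (1 - φ z))` in the coordinate `w = log (z - z₀)`. -/
noncomputable def phaseExp (z₀ p₀ : ℂ) (φ : ℂ → ℂ) (μ : ℕ) (N : ℝ) (w : ℂ) : ℂ :=
  Complex.exp (-(N * p₀ * Complex.exp (μ * w) * (1 - φ (z₀ + Complex.exp w))))

variable {z₀ a p₀ : ℂ} {φ : ℂ → ℂ} {μ : ℕ} {r ρ : ℝ}

theorem add_exp_mem_ball_iff {w : ℂ} :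
    z₀ + Complex.exp w ∈ Metric.ball z₀ r ↔ Real.exp w.re < r := by
  simp [Complex.norm_exp]

theorem add_exp_mem_closedBall_iff {w : ℂ} :
    z₀ + Complex.exp w ∈ Metric.closedBall z₀ r ↔ Real.exp w.re ≤ r := by
  simp [Complex.norm_exp]

theorem mul_angle (hμ : 1 ≤ μ) (k : ℤ) :
    (μ : ℝ) * angle p₀ μ k = 2 * Real.pi * k - Complex.arg p₀ := by
  have hμ0 : (μ : ℝ) ≠ 0 := Nat.cast_ne_zero.2 (by omega)
  unfold angle
  field_simp
  ring

/-- `μ θ_k` equals `-arg p₀` modulo `2π`, so `p₀ (z - z₀)^μ` is positive on the ray. -/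
theorem mul_exp_angle (hμ : 1 ≤ μ) (k : ℤ) (x : ℝ) :
    p₀ * Complex.exp (μ * (x + angle p₀ μ k * Complex.I)) =
      ((‖p₀‖ * Real.exp (μ * x) : ℝ) : ℂ) := by
  have h1 : (μ : ℂ) * (x + angle p₀ μ k * Complex.I) =
      (μ * x : ℝ) + (k * (2 * Real.pi * Complex.I) - Complex.arg p₀ * Complex.I) := by
    have h2 : (μ : ℂ) * (angle p₀ μ k : ℝ) = 2 * Real.pi * k - Complex.arg p₀ := by
      exact_mod_cast congrArg (fun x : ℝ => (x : ℂ)) (mul_angle (p₀ := p₀) hμ k)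
    push_cast
    linear_combination Complex.I * h2
  have h3 : p₀ = ‖p₀‖ * Complex.exp (Complex.arg p₀ * Complex.I) :=
    (Complex.norm_mul_exp_arg_mul_I p₀).symm
  rw [h1, Complex.exp_add, Complex.exp_sub, Complex.exp_int_mul_two_pi_mul_I]
  nth_rewrite 1 [h3]
  have := Complex.exp_ne_zero (Complex.arg p₀ * Complex.I)
  push_cast
  field_simp

/-- Along a steepest-descent ray and its branches, the logarithm of `N p₀ (z - z₀) ^ μ (1 - φ z)`
in the coordinate `w = log (z - z₀)`. -/
noncomputable def phaseLog (z₀ p₀ : ℂ) (φ : ℂ → ℂ) (μ : ℕ) (N : ℝ) (w : ℂ) : ℂ :=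
  μ * w + Complex.log (1 - φ (z₀ + Complex.exp w)) + (Real.log N + Complex.log p₀)

theorem SmallOn.exp_phaseLog (h : SmallOn z₀ φ r) (hp₀ : p₀ ≠ 0) {N : ℝ} (hN : 0 < N) {w : ℂ}
    (hw : z₀ + Complex.exp w ∈ Metric.ball z₀ r) :
    Complex.exp (phaseLog z₀ p₀ φ μ N w) =
      N * p₀ * Complex.exp (μ * w) * (1 - φ (z₀ + Complex.exp w)) := by
  have hNC : (N : ℂ) ≠ 0 := by exact_mod_cast hN.ne'
  rw [phaseLog, Complex.exp_add, Complex.exp_add, Complex.exp_add, Complex.exp_log (h.ne_zero hw),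
    Complex.exp_log hp₀, Complex.ofReal_log hN.le, Complex.exp_log hNC]
  ring

theorem SmallOn.hasDerivAt_phaseLog (h : SmallOn z₀ φ r) (hμ : 1 ≤ μ) (N : ℝ) {w : ℂ}
    (hw : z₀ + Complex.exp w ∈ Metric.ball z₀ r) :
    HasDerivAt (phaseLog z₀ p₀ φ μ N) (μ * kappa z₀ φ μ (z₀ + Complex.exp w)) w := by
  have hμ0 : (μ : ℂ) ≠ 0 := Nat.cast_ne_zero.2 (by omega)
  have h1 : HasDerivAt (fun w => 1 - φ (z₀ + Complex.exp w))
      (-(deriv φ (z₀ + Complex.exp w) * Complex.exp w)) w := by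
    have h2 : HasDerivAt (fun w => z₀ + Complex.exp w) (Complex.exp w) w :=
      (Complex.hasDerivAt_exp w).const_add z₀
    exact ((h.differentiableAt hw).hasDerivAt.comp w h2).const_sub 1
  have h3 := ((((hasDerivAt_id w).const_mul (μ : ℂ)).add (h1.clog (h.mem_slitPlane hw))).add_const
    (Real.log N + Complex.log p₀))
  refine h3.congr_deriv ?_
  have h4 := h.ne_zero hw
  rw [kappa]
  simp only [add_sub_cancel_left]
  field_simp
  ring

/-- The primitive is a constant times `Θ ∘ phaseLog`, with `Θ` a primitive of `hankel β`. Its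
increment is the Hankel jump up to the two tails beyond radius `ρ`. -/
theorem SmallOn.exists_monomial_asymptotics (h : SmallOn z₀ φ r) (hμ : 1 ≤ μ) (hp₀ : p₀ ≠ 0)
    (hρ : 0 < ρ) (hρr : ρ < r) {N₀ : ℝ} (hN₀ : 0 < N₀) (a : ℂ) (k₁ k₂ : ℤ) {s S : ℕ}
    (hs : s < S) :
    ∃ C : ℝ, 0 ≤ C ∧ ∀ N : ℝ, N₀ ≤ N → ∃ P : ℂ → ℂ,
      (∀ w, z₀ + Complex.exp w ∈ Metric.ball z₀ r →
        HasDerivAt P (phaseExp z₀ p₀ φ μ N w * Complex.exp ((s + a) * w) *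
          monomialFactor z₀ a φ μ s (z₀ + Complex.exp w)) w) ∧
      ‖P (Real.log ρ + angle p₀ μ k₂ * Complex.I) - P (Real.log ρ + angle p₀ μ k₁ * Complex.I) -
        gammaFactor a μ k₁ k₂ s * (1 / μ * p₀ ^ (-((s : ℂ) + a) / (μ : ℂ))) /
          (N : ℂ) ^ (((s : ℂ) + a) / (μ : ℂ))‖ ≤ C / N ^ (((S : ℝ) + a.re) / (μ : ℝ)) := by
  have hμ0 : (μ : ℂ) ≠ 0 := Nat.cast_ne_zero.2 (by omega)
  have hμR : (0 : ℝ) < μ := by exact_mod_cast hμ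
  set β : ℂ := ((s : ℂ) + a) / (μ : ℂ) with hβ
  obtain ⟨Θ, hΘ⟩ := exists_primitive_hankel β
  choose l hl using exists_tendsto_hankel hΘ
  have hjump := hasHankelJump_gammaFactor a μ k₁ k₂ s Θ (l k₁) (l k₂) hΘ (hl k₁) (hl k₂)
  -- Any rate of decay is available for the tails; this one raises `N^{-(s + Re a)/μ}` to the order
  -- of the remainder.
  have hM : (0 : ℝ) < (S - s) / μ := div_pos (sub_pos.2 (by exact_mod_cast hs)) hμR
  have hmem : ∀ k : ℤ, z₀ + Complex.exp (Real.log ρ + angle p₀ μ k * Complex.I) ∈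
      Metric.ball z₀ r := fun k => by
    rw [add_exp_mem_ball_iff]; simpa [Real.exp_log hρ] using hρr
  have htail : ∀ k : ℤ, ∃ C : ℝ, 0 ≤ C ∧ ∀ N : ℝ, N₀ ≤ N →
      ‖l k - Θ (phaseLog z₀ p₀ φ μ N (Real.log ρ + angle p₀ μ k * Complex.I))‖ ≤
        C / N ^ (((S : ℝ) - s) / μ) := by
    intro k
    set ζ := 1 - φ (z₀ + Complex.exp (Real.log ρ + angle p₀ μ k * Complex.I)) with hζ
    have hη : |Complex.arg ζ| < Real.pi / 2 :=
      Complex.abs_arg_lt_pi_div_two_iff.2 (Or.inl (by linarith [h.re_pos (hmem k)]))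
    set b : ℝ := μ * Real.log ρ + Real.log ‖ζ‖ + Real.log ‖p₀‖ with hb
    obtain ⟨C, hC, hC'⟩ := exists_hankel_tail hΘ k (hl k) (abs_nonneg _) hη hM (Real.log N₀ + b)
    refine ⟨C * Real.exp (-((S - s) / μ) * b), by positivity, fun N hN => ?_⟩
    have hN0 : 0 < N := hN₀.trans_le hN
    -- The endpoint lies at height `arg ζ` from the line `Im v = 2πk`, and `|arg ζ| < π/2` because
    -- `Re ζ > 0`.
    have hval : phaseLog z₀ p₀ φ μ N (Real.log ρ + angle p₀ μ k * Complex.I) =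
        (Real.log N + b : ℝ) + (2 * Real.pi * k + Complex.arg ζ : ℝ) * Complex.I := by
      have h2 : (μ : ℝ) * angle p₀ μ k = 2 * Real.pi * k - Complex.arg p₀ := mul_angle hμ k
      rw [phaseLog, ← hζ, hb]
      apply Complex.ext
      · simp [Complex.log_re]; ring
      · simp [Complex.log_im]; linarith
    have := hC' (Real.log N + b) (2 * Real.pi * k + Complex.arg ζ)
      (by gcongr) (by rw [add_sub_cancel_left])
    rw [hval]
    refine this.trans (le_of_eq ?_)
    rw [mul_add, Real.exp_add, neg_mul _ (Real.log N), Real.exp_neg, mul_comm _ (Real.log N),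
      ← Real.rpow_def_of_pos hN0]
    ring
  obtain ⟨C₁, hC₁, h₁⟩ := htail k₁
  obtain ⟨C₂, hC₂, h₂⟩ := htail k₂
  set A : ℂ := 1 / μ * p₀ ^ (-((s : ℂ) + a) / (μ : ℂ)) with hA
  refine ⟨‖A‖ * (C₂ + C₁), by positivity, fun N hN => ?_⟩
  have hN0 : 0 < N := hN₀.trans_le hN
  have hNC : (N : ℂ) ≠ 0 := by exact_mod_cast hN0.ne'
  refine ⟨fun w => A / (N : ℂ) ^ β * Θ (phaseLog z₀ p₀ φ μ N w), fun w hw => ?_, ?_⟩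
  · have h3 := ((hΘ _).comp w (h.hasDerivAt_phaseLog (p₀ := p₀) hμ N hw)).const_mul
      (A / (N : ℂ) ^ β)
    refine h3.congr_deriv ?_
    have h4 : hankel β (phaseLog z₀ p₀ φ μ N w) = phaseExp z₀ p₀ φ μ N w *
        (Complex.exp ((s + a) * w) * (1 - φ (z₀ + Complex.exp w)) ^ β * (N : ℂ) ^ β * p₀ ^ β) := by
      have h7 : Complex.exp (β * phaseLog z₀ p₀ φ μ N w) = Complex.exp ((s + a) * w) *
          (1 - φ (z₀ + Complex.exp w)) ^ β * (N : ℂ) ^ β * p₀ ^ β := by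
        rw [Complex.cpow_def_of_ne_zero hNC, Complex.cpow_def_of_ne_zero hp₀,
          Complex.cpow_def_of_ne_zero (h.ne_zero hw), ← Complex.exp_add, ← Complex.exp_add,
          ← Complex.exp_add, phaseLog, Complex.ofReal_log hN0.le]
        congr 1
        rw [hβ]
        field_simp
        ring
      rw [hankel, Complex.exp_add, h.exp_phaseLog hp₀ hN0 hw, h7, phaseExp]
    have h5 : p₀ ^ (-((s : ℂ) + a) / (μ : ℂ)) * p₀ ^ β = 1 := by
      rw [neg_div, ← hβ, Complex.cpow_neg, inv_mul_cancel₀]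
      rw [Complex.cpow_def_of_ne_zero hp₀]; exact Complex.exp_ne_zero _
    have h6 : (N : ℂ) ^ β ≠ 0 := by
      rw [Complex.cpow_def_of_ne_zero hNC]; exact Complex.exp_ne_zero _
    rw [h4, monomialFactor, ← hβ, hA]
    generalize p₀ ^ (-((s : ℂ) + a) / (μ : ℂ)) = P at h5
    generalize p₀ ^ β = Q at h5
    generalize (N : ℂ) ^ β = X at h6
    generalize Complex.exp ((s + a) * w) = Y
    field_simp
    linear_combination (phaseExp z₀ p₀ φ μ N w * Y *
      (1 - φ (z₀ + Complex.exp w)) ^ β * kappa z₀ φ μ (z₀ + Complex.exp w)) * h5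
  · have hnN : ‖(N : ℂ) ^ β‖ = N ^ (((s : ℝ) + a.re) / μ) := by
      rw [Complex.norm_cpow_eq_rpow_re_of_pos hN0, hβ]
      congr 1
      simp
    set X₁ := Θ (phaseLog z₀ p₀ φ μ N (Real.log ρ + angle p₀ μ k₁ * Complex.I))
    set X₂ := Θ (phaseLog z₀ p₀ φ μ N (Real.log ρ + angle p₀ μ k₂ * Complex.I))
    have heq : A / (N : ℂ) ^ β * X₂ - A / (N : ℂ) ^ β * X₁ - gammaFactor a μ k₁ k₂ s * A /
        (N : ℂ) ^ β = A / (N : ℂ) ^ β * ((l k₁ - X₁) - (l k₂ - X₂)) := by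
      rw [← hjump]; ring
    rw [heq, norm_mul, norm_div, hnN]
    have hsplit : N ^ (((S : ℝ) + a.re) / μ) =
        N ^ (((s : ℝ) + a.re) / μ) * N ^ (((S : ℝ) - s) / μ) := by
      rw [← Real.rpow_add hN0]; congr 1; ring
    have hle : ‖(l k₁ - X₁) - (l k₂ - X₂)‖ ≤ (C₂ + C₁) / N ^ (((S : ℝ) - s) / μ) := by
      refine (norm_sub_le _ _).trans ((add_le_add (h₁ N hN) (h₂ N hN)).trans (le_of_eq ?_))
      ring
    calc _ ≤ ‖A‖ / N ^ (((s : ℝ) + a.re) / μ) * ((C₂ + C₁) / N ^ (((S : ℝ) - s) / μ)) := by gcongr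
      _ = _ := by rw [hsplit, div_mul_div_comm]

/-- The rectangle on which the remainder is estimated: it reaches from the modulus `ρ` down to a
modulus proportional to `N ^ (-1 / μ)`. -/
def shrinkingRect (p₀ : ℂ) (μ : ℕ) (ρ N₀ N : ℝ) (k₁ k₂ : ℤ) : Set ℂ :=
  {w | w.re ∈ Icc (Real.log ρ - Real.log (N / N₀) / μ) (Real.log ρ) ∧
    w.im ∈ uIcc (angle p₀ μ k₁) (angle p₀ μ k₂)}

/-- The increment is taken along three sides of the rectangle: down one ray, across at radius `ρ
(N₀/N)^{1/μ}`, and up the other. On the rays `Re (1 - φ) > 1/2` keeps the exponential decaying; on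
the crossing the exponent is bounded. -/
theorem SmallOn.exists_remainder_bound (h : SmallOn z₀ φ r) (hμ : 1 ≤ μ) (hp₀ : p₀ ≠ 0)
    (hρ : 0 < ρ) (hρr : ρ < r) {N₀ : ℝ} (hN₀ : 0 < N₀) (a : ℂ) (k₁ k₂ : ℤ) (S : ℕ) :
    ∃ C : ℝ, 0 ≤ C ∧ ∀ (t : ℂ → ℂ) (B : ℝ), (∀ z ∈ Metric.closedBall z₀ ρ, ‖t z‖ ≤ B) →
      ∀ N : ℝ, N₀ ≤ N → ∀ F : ℂ → ℂ,
      (∀ w ∈ shrinkingRect p₀ μ ρ N₀ N k₁ k₂,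
        HasDerivAt F (phaseExp z₀ p₀ φ μ N w * Complex.exp ((S + a) * w) *
          t (z₀ + Complex.exp w)) w) →
      ‖F (Real.log ρ + angle p₀ μ k₂ * Complex.I) - F (Real.log ρ + angle p₀ μ k₁ * Complex.I)‖ ≤
        C * (B / N ^ (((S : ℝ) + a.re) / (μ : ℝ))) := by
  have hμR : (0 : ℝ) < μ := by exact_mod_cast hμ
  set σ : ℝ := (S : ℝ) + a.re with hσ
  set θ₁ := angle p₀ μ k₁ with hθ₁
  set θ₂ := angle p₀ μ k₂ with hθ₂
  obtain ⟨Y, hY⟩ := (isCompact_uIcc (a := θ₁) (b := θ₂)).exists_bound_of_continuousOn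
    (f := fun y : ℝ => a.im * y) (by fun_prop)
  have hδ : 0 < ‖p₀‖ * N₀ / 2 := by positivity
  -- At `μx` this exponent gives `e^{-(σ+1)x}`, which cancels `e^{σx}` and leaves the integrable
  -- factor `e^{-x}`.
  obtain ⟨D, hD, hD'⟩ := exists_exp_neg_exp_le hδ (μ * Real.log ρ) ((σ + 1) / μ)
  set E₁ : ℝ := D * Real.exp Y / ρ with hE₁
  set E₂ : ℝ := Real.exp (N₀ * ‖p₀‖ * ρ ^ μ * (3 / 2)) * Real.exp (σ * Real.log ρ + Y) *
    |θ₂ - θ₁| with hE₂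
  refine ⟨(2 * E₁ + E₂) * N₀ ^ (σ / μ), by positivity, fun t B hB N hN F hF => ?_⟩
  have hN0 : 0 < N := hN₀.trans_le hN
  have hB0 : 0 ≤ B := (norm_nonneg _).trans (hB z₀ (Metric.mem_closedBall_self hρ.le))
  -- Chosen so that `N e^{-μτ} = N₀`: a shift by `τ` replaces `N` by `N₀` in the leading part of the
  -- phase and produces the factor `e^{-στ} = (N₀/N)^{σ/μ}`.
  set τ : ℝ := Real.log (N / N₀) / μ with hτ
  have hτ0 : 0 ≤ τ := div_nonneg (Real.log_nonneg ((one_le_div hN₀).2 hN)) hμR.le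
  have hNτ : N * Real.exp (-(μ * τ)) = N₀ := by
    rw [hτ, mul_div_cancel₀ _ hμR.ne', Real.exp_neg, Real.exp_log (by positivity)]
    field_simp
  have hστ : Real.exp (-(σ * τ)) = N₀ ^ (σ / μ) / N ^ (σ / μ) := by
    rw [← Real.div_rpow hN₀.le hN0.le, Real.rpow_def_of_pos (by positivity), hτ,
      ← inv_div N N₀, Real.log_inv]
    congr 1
    ring
  have hnexp : ∀ x y : ℝ, y ∈ uIcc θ₁ θ₂ →
      ‖Complex.exp ((S + a) * (x + y * Complex.I))‖ ≤ Real.exp (σ * x) * Real.exp Y := by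
    intro x y hy
    rw [Complex.norm_exp, ← Real.exp_add]
    apply Real.exp_le_exp.2
    have h1 : -(a.im * y) ≤ Y := (neg_le_abs _).trans (hY y hy)
    simp [hσ]
    linarith
  have hball : ∀ x y : ℝ, x ≤ Real.log ρ →
      z₀ + Complex.exp (x + y * Complex.I) ∈ Metric.closedBall z₀ ρ := by
    intro x y hx
    rw [add_exp_mem_closedBall_iff]
    simpa using (Real.exp_le_exp.2 hx).trans (Real.exp_log hρ).le
  have hsub : Metric.closedBall z₀ ρ ⊆ Metric.ball z₀ r := Metric.closedBall_subset_ball hρr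
  have hhor : ∀ k : ℤ, angle p₀ μ k ∈ uIcc θ₁ θ₂ →
      ‖F (Real.log ρ + angle p₀ μ k * Complex.I) -
        F ((Real.log ρ - τ : ℝ) + angle p₀ μ k * Complex.I)‖ ≤
        E₁ * (N₀ ^ (σ / μ) * (B / N ^ (σ / μ))) := by
    intro k hk
    have hder : ∀ x ∈ Icc (Real.log ρ) (Real.log ρ + τ),
        HasDerivAt (fun u : ℝ => F ((u - τ : ℝ) + angle p₀ μ k * Complex.I))
          ((1 : ℝ) • (phaseExp z₀ p₀ φ μ N ((x - τ : ℝ) + angle p₀ μ k * Complex.I) *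
            Complex.exp ((S + a) * ((x - τ : ℝ) + angle p₀ μ k * Complex.I)) *
            t (z₀ + Complex.exp ((x - τ : ℝ) + angle p₀ μ k * Complex.I)))) x := by
      intro x hx
      have h1 := hasDerivAt_comp_horizontal (x := x - τ) (y := angle p₀ μ k) (hF _ (by
        refine ⟨?_, ?_⟩
        · simp only [Complex.add_re, Complex.ofReal_re, Complex.mul_re, Complex.I_re,
            Complex.ofReal_im, Complex.I_im, mul_zero, mul_one, sub_self, add_zero]
          exact ⟨by linarith [hx.1], by linarith [hx.2]⟩
        · simpa using hk))
      exact h1.scomp x ((hasDerivAt_id x).sub_const τ)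
    have hbd : ∀ x ∈ Icc (Real.log ρ) (Real.log ρ + τ),
        ‖(1 : ℝ) • (phaseExp z₀ p₀ φ μ N ((x - τ : ℝ) + angle p₀ μ k * Complex.I) *
          Complex.exp ((S + a) * ((x - τ : ℝ) + angle p₀ μ k * Complex.I)) *
          t (z₀ + Complex.exp ((x - τ : ℝ) + angle p₀ μ k * Complex.I)))‖ ≤
        D * Real.exp Y * Real.exp (-(σ * τ)) * B * Real.exp (-1 * x) := by
      intro x hx
      have hx' : x - τ ≤ Real.log ρ := by linarith [hx.2]
      have hb := hball (x - τ) (angle p₀ μ k) hx'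
      have h1 : ‖phaseExp z₀ p₀ φ μ N ((x - τ : ℝ) + angle p₀ μ k * Complex.I)‖ ≤
          Real.exp (-(‖p₀‖ * N₀ / 2) * Real.exp (μ * x)) := by
        rw [phaseExp, mul_assoc (N : ℂ), mul_exp_angle hμ, ← Complex.ofReal_mul,
          Complex.norm_exp, Complex.neg_re, Complex.re_ofReal_mul]
        apply Real.exp_le_exp.2
        have h2 : N * (‖p₀‖ * Real.exp (μ * (x - τ))) = ‖p₀‖ * N₀ * Real.exp (μ * x) := by
          rw [mul_sub, sub_eq_add_neg, Real.exp_add, ← hNτ]; ring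
        rw [h2]
        have h3 := (h.re_pos (hsub hb)).le
        have h4 : 0 ≤ ‖p₀‖ * N₀ * Real.exp (μ * x) := by positivity
        nlinarith [mul_le_mul_of_nonneg_left h3 h4]
      have h5 := hD' (μ * x) (by gcongr; exact hx.1)
      rw [one_smul, norm_mul, norm_mul]
      calc _ ≤ (D * Real.exp (-((σ + 1) / μ) * (μ * x))) *
            (Real.exp (σ * (x - τ)) * Real.exp Y) * B := by
            gcongr
            · exact h1.trans h5
            · exact hnexp _ _ hk
            · exact hB _ hb
        _ = _ := by
            have h6 : -((σ + 1) / μ) * (μ * x) = -(σ * x) + -1 * x := by field_simp; ring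
            have h7 : σ * (x - τ) = σ * x + -(σ * τ) := by ring
            have h8 : Real.exp (-(σ * x)) * Real.exp (σ * x) = 1 := by
              rw [← Real.exp_add]; simp
            rw [h6, h7, Real.exp_add, Real.exp_add]
            linear_combination (D * Real.exp (-1 * x) * Real.exp (-(σ * τ)) * Real.exp Y * B) * h8
    have := norm_sub_le_of_exp_decay (by positivity) zero_lt_one (by linarith) hder hbd
    simp only [add_sub_cancel_right] at this
    refine this.trans (le_of_eq ?_)
    rw [hστ, neg_mul, one_mul, Real.exp_neg, Real.exp_log hρ, hE₁]
    field_simp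
  have hver : ‖F ((Real.log ρ - τ : ℝ) + θ₂ * Complex.I) -
      F ((Real.log ρ - τ : ℝ) + θ₁ * Complex.I)‖ ≤
        E₂ * (N₀ ^ (σ / μ) * (B / N ^ (σ / μ))) := by
    refine (norm_sub_le_of_vertical (f := fun w => phaseExp z₀ p₀ φ μ N w *
      Complex.exp ((S + a) * w) * t (z₀ + Complex.exp w)) (A := Real.exp (N₀ * ‖p₀‖ * ρ ^ μ * (3 / 2)) *
      (Real.exp (σ * Real.log ρ + Y) * Real.exp (-(σ * τ))) * B) (fun y hy => hF _ ?_)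
      fun y hy => ?_).trans (le_of_eq ?_)
    · refine ⟨?_, by simpa using hy⟩
      simpa [← hτ] using hτ0
    · have hb := hball (Real.log ρ - τ) y (by linarith)
      rw [norm_mul, norm_mul]
      have h1 : ‖phaseExp z₀ p₀ φ μ N ((Real.log ρ - τ : ℝ) + y * Complex.I)‖ ≤
          Real.exp (N₀ * ‖p₀‖ * ρ ^ μ * (3 / 2)) := by
        rw [phaseExp]
        refine (Complex.norm_exp_le_exp_norm _).trans (Real.exp_le_exp.2 ?_)
        rw [norm_neg, norm_mul, norm_mul, norm_mul, Complex.norm_exp, Complex.norm_real,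
          Real.norm_of_nonneg hN0.le]
        have h2 : N * ‖p₀‖ * Real.exp ((μ : ℂ) * ((Real.log ρ - τ : ℝ) + y * Complex.I)).re =
            N₀ * ‖p₀‖ * ρ ^ μ := by
          have h3 : ((μ : ℂ) * ((Real.log ρ - τ : ℝ) + y * Complex.I)).re =
              μ * Real.log ρ + -(μ * τ) := by simp; ring
          rw [h3, Real.exp_add, ← hNτ, Real.exp_nat_mul, Real.exp_log hρ]
          ring
        rw [h2]
        have h4 : ‖1 - φ (z₀ + Complex.exp ((Real.log ρ - τ : ℝ) + y * Complex.I))‖ ≤ 3 / 2 := by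
          refine (norm_sub_le _ _).trans ?_
          rw [norm_one]
          linarith [h.lt _ (hsub hb)]
        gcongr
      have h5 : Real.exp (σ * Real.log ρ + Y) * Real.exp (-(σ * τ)) =
          Real.exp (σ * (Real.log ρ - τ)) * Real.exp Y := by
        rw [← Real.exp_add, ← Real.exp_add]; congr 1; ring
      rw [h5]
      gcongr
      · exact hnexp _ _ hy
      · exact hB _ hb
    · rw [hστ, hE₂]; ring
  have e₁ := hhor k₁ left_mem_uIcc
  have e₂ := hhor k₂ right_mem_uIcc
  rw [← hθ₁] at e₁
  rw [← hθ₂] at e₂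
  set w₁ := F (Real.log ρ + θ₁ * Complex.I)
  set w₂ := F (Real.log ρ + θ₂ * Complex.I)
  set v₁ := F ((Real.log ρ - τ : ℝ) + θ₁ * Complex.I)
  set v₂ := F ((Real.log ρ - τ : ℝ) + θ₂ * Complex.I)
  calc ‖w₂ - w₁‖ = ‖(w₂ - v₂) + (v₂ - v₁) - (w₁ - v₁)‖ := by congr 1; ring
    _ ≤ ‖w₂ - v₂‖ + ‖v₂ - v₁‖ + ‖w₁ - v₁‖ :=
      (norm_sub_le _ _).trans (add_le_add_left (norm_add_le _ _) _)
    _ ≤ _ := add_le_add (add_le_add e₂ hver) e₁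
    _ = _ := by ring

end Perron

/-! ### Local asymptotics and tools for the logarithmic coordinate -/

namespace Perron

variable {z₀ a p₀ : ℂ} {φ : ℂ → ℂ} {μ : ℕ} {r ρ : ℝ}

theorem alpha_eq (z₀ a : ℂ) (q φ : ℂ → ℂ) (μ : ℕ) (p₀ : ℂ) (s : ℕ) :
    alpha z₀ a q φ μ p₀ s =
      1 / μ * p₀ ^ (-((s : ℂ) + a) / (μ : ℂ)) * expansionCoeff z₀ a φ μ s q := by
  rw [alpha, expansionCoeff, one_div, mul_inv]
  ring

/-- After subtraction of the explicit primitives of the monomial terms, `F` becomes a primitive of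
the remainder differential. -/
theorem SmallOn.exists_local_asymptotics (h : SmallOn z₀ φ r) (hμ : 1 ≤ μ) (hp₀ : p₀ ≠ 0)
    (hρ : 0 < ρ) (hρr : ρ < r) {N₀ : ℝ} (hN₀ : 0 < N₀) (a : ℂ) (k₁ k₂ : ℤ) (S : ℕ) :
    ∃ C : ℝ, 0 ≤ C ∧ ∀ (q : ℂ → ℂ) (K : ℝ), DifferentiableOn ℂ q (Metric.ball z₀ r) →
      (∀ z ∈ Metric.ball z₀ r, ‖q z‖ ≤ K) → ∀ N : ℝ, N₀ ≤ N → ∀ F : ℂ → ℂ,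
      (∀ w ∈ shrinkingRect p₀ μ ρ N₀ N k₁ k₂,
        HasDerivAt F (phaseExp z₀ p₀ φ μ N w * Complex.exp (a * w) * q (z₀ + Complex.exp w)) w) →
      ‖F (Real.log ρ + angle p₀ μ k₂ * Complex.I) - F (Real.log ρ + angle p₀ μ k₁ * Complex.I) -
        ∑ s ∈ Finset.range S, gammaFactor a μ k₁ k₂ s * alpha z₀ a q φ μ p₀ s /
          (N : ℂ) ^ (((s : ℂ) + a) / (μ : ℂ))‖ ≤ C * (K / N ^ (((S : ℝ) + a.re) / (μ : ℝ))) := by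
  have hr : 0 < r := hρ.trans hρr
  choose B hB0 hB using h.exists_expansionCoeff_bound hr a μ
  obtain ⟨C₁, hC₁, hexp⟩ := h.exists_bounded_expansion hμ hρ hρr a S
  obtain ⟨C₂, hC₂, hrem⟩ := h.exists_remainder_bound hμ hp₀ hρ hρr hN₀ a k₁ k₂ S
  -- For `s ≥ S` the constant `0` serves as a default, so that a constant can be chosen for every
  -- `s`.
  have hmono : ∀ s : ℕ, ∃ C : ℝ, 0 ≤ C ∧ (s < S → ∀ N : ℝ, N₀ ≤ N → ∃ P : ℂ → ℂ,
      (∀ w, z₀ + Complex.exp w ∈ Metric.ball z₀ r →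
        HasDerivAt P (phaseExp z₀ p₀ φ μ N w * Complex.exp ((s + a) * w) *
          monomialFactor z₀ a φ μ s (z₀ + Complex.exp w)) w) ∧
      ‖P (Real.log ρ + angle p₀ μ k₂ * Complex.I) - P (Real.log ρ + angle p₀ μ k₁ * Complex.I) -
        gammaFactor a μ k₁ k₂ s * (1 / μ * p₀ ^ (-((s : ℂ) + a) / (μ : ℂ))) /
          (N : ℂ) ^ (((s : ℂ) + a) / (μ : ℂ))‖ ≤ C / N ^ (((S : ℝ) + a.re) / (μ : ℝ))) := by
    intro s
    by_cases hs : s < S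
    · obtain ⟨C, hC, hC'⟩ := h.exists_monomial_asymptotics hμ hp₀ hρ hρr hN₀ a k₁ k₂ hs
      exact ⟨C, hC, fun _ => hC'⟩
    · exact ⟨0, le_rfl, fun h => absurd h hs⟩
  choose D hD0 hD using hmono
  refine ⟨C₂ * C₁ + ∑ s ∈ Finset.range S, B s * D s, add_nonneg (mul_nonneg hC₂ hC₁)
    (Finset.sum_nonneg fun s _ => mul_nonneg (hB0 s) (hD0 s)), fun q K hq hK N hN F hF => ?_⟩
  have hN0 : 0 < N := hN₀.trans_le hN
  obtain ⟨t, ht, heq, htb⟩ := hexp q K hq hK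
  choose! P hP hP' using fun s hs => hD s hs N hN
  set d : ℕ → ℂ := fun s => expansionCoeff z₀ a φ μ s q with hd
  set w₁ : ℂ := Real.log ρ + angle p₀ μ k₁ * Complex.I
  set w₂ : ℂ := Real.log ρ + angle p₀ μ k₂ * Complex.I
  have hR := hrem t (C₁ * K) htb N hN (fun w => F w - ∑ s ∈ Finset.range S, d s * P s w)
    (fun w hw => by
      have hwb : z₀ + Complex.exp w ∈ Metric.ball z₀ r := by
        rw [add_exp_mem_ball_iff]
        exact ((Real.exp_le_exp.2 hw.1.2).trans (Real.exp_log hρ).le).trans_lt hρr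
      refine ((hF w hw).sub (HasDerivAt.fun_sum fun s hs =>
        (hP s (Finset.mem_range.1 hs) w hwb).const_mul (d s))).congr_deriv ?_
      have hpow : ∀ s : ℕ, Complex.exp ((s + a) * w) = Complex.exp (a * w) * Complex.exp w ^ s :=
        fun s => by rw [← Complex.exp_nat_mul, ← Complex.exp_add]; ring_nf
      rw [heq _ hwb, hpow S, mul_add, Finset.mul_sum, add_sub_right_comm, ← Finset.sum_sub_distrib]
      simp only [add_sub_cancel_left]
      rw [Finset.sum_eq_zero, zero_add]
      · ring
      · intro s _
        rw [hpow s]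
        ring)
  have hsplit : F w₂ - F w₁ - ∑ s ∈ Finset.range S, gammaFactor a μ k₁ k₂ s *
      alpha z₀ a q φ μ p₀ s / (N : ℂ) ^ (((s : ℂ) + a) / (μ : ℂ)) =
      ((F w₂ - ∑ s ∈ Finset.range S, d s * P s w₂) -
        (F w₁ - ∑ s ∈ Finset.range S, d s * P s w₁)) +
      ∑ s ∈ Finset.range S, d s * (P s w₂ - P s w₁ - gammaFactor a μ k₁ k₂ s *
        (1 / μ * p₀ ^ (-((s : ℂ) + a) / (μ : ℂ))) / (N : ℂ) ^ (((s : ℂ) + a) / (μ : ℂ))) := by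
    have : ∑ s ∈ Finset.range S, d s * (P s w₂ - P s w₁ - gammaFactor a μ k₁ k₂ s *
        (1 / μ * p₀ ^ (-((s : ℂ) + a) / (μ : ℂ))) / (N : ℂ) ^ (((s : ℂ) + a) / (μ : ℂ))) =
        ∑ s ∈ Finset.range S, d s * P s w₂ - ∑ s ∈ Finset.range S, d s * P s w₁ -
        ∑ s ∈ Finset.range S, gammaFactor a μ k₁ k₂ s * alpha z₀ a q φ μ p₀ s /
          (N : ℂ) ^ (((s : ℂ) + a) / (μ : ℂ)) := by
      rw [← Finset.sum_sub_distrib, ← Finset.sum_sub_distrib]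
      refine Finset.sum_congr rfl fun s _ => ?_
      rw [alpha_eq]
      simp only [hd]
      ring
    rw [this]
    ring
  rw [hsplit]
  refine (norm_add_le _ _).trans ((add_le_add hR ((norm_sum_le _ _).trans
    (Finset.sum_le_sum (g := fun s => B s * K * (D s / N ^ (((S : ℝ) + a.re) / (μ : ℝ))))
      fun s hs => ?_))).trans (le_of_eq ?_))
  · rw [norm_mul]
    have hb := hB s q K hq hK
    exact mul_le_mul hb (hP' s (Finset.mem_range.1 hs)) (norm_nonneg _)
      ((norm_nonneg _).trans hb)
  · rw [add_mul, Finset.sum_mul]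
    congr 1
    · ring
    · exact Finset.sum_congr rfl fun s _ => by ring

/-- A sufficiently large disk tangent to the line `Re w = x₂` from the left contains the rectangle,
and on a disk a primitive exists. -/
theorem exists_primitive_on_rect {f : ℂ → ℂ} {x₀ x₁ x₂ Y : ℝ} (hx : x₁ < x₂)
    (hf : DifferentiableOn ℂ f {w | w.re < x₂}) :
    ∃ F : ℂ → ℂ, ∀ w : ℂ, x₀ ≤ w.re → w.re ≤ x₁ → |w.im| ≤ Y → HasDerivAt F (f w) w := by
  set Q : ℝ := (x₂ - x₀) ^ 2 + Y ^ 2 with hQ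
  -- Membership of `w` in the disk reads `(x₂ - Re w)² + (Im w)² < 2M (x₂ - Re w)`. The left side is
  -- at most `Q`, and `2M (x₂ - x₁) > Q`.
  set M : ℝ := Q / (2 * (x₂ - x₁)) + 1 with hM
  have hδ : 0 < x₂ - x₁ := sub_pos.2 hx
  have hM0 : 0 < M := by positivity
  have hsub : Metric.ball (((x₂ - M : ℝ)) : ℂ) M ⊆ {w | w.re < x₂} := by
    intro w hw
    have h1 := (Complex.re_le_norm _).trans_lt (mem_ball_iff_norm.1 hw)
    simp only [Complex.sub_re, Complex.ofReal_re] at h1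
    change w.re < x₂
    linarith
  obtain ⟨F, hF⟩ := (hf.mono hsub).isExactOn_ball
  refine ⟨F, fun w h₀ h₁ hY => hF w ?_⟩
  rw [mem_ball_iff_norm]
  refine lt_of_pow_lt_pow_left₀ 2 hM0.le ?_
  rw [← Complex.normSq_eq_norm_sq, Complex.normSq_apply]
  simp only [Complex.sub_re, Complex.ofReal_re, Complex.sub_im, Complex.ofReal_im, sub_zero]
  have h2 : w.im * w.im ≤ Y ^ 2 := by nlinarith [abs_nonneg w.im, abs_mul_abs_self w.im]
  have h3 : (x₂ - w.re) ^ 2 ≤ (x₂ - x₀) ^ 2 := pow_le_pow_left₀ (by linarith) (by linarith) 2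
  have h4 : 2 * M * (x₂ - x₁) = Q + 2 * (x₂ - x₁) := by rw [hM]; field_simp
  have h5 : 2 * M * (x₂ - x₁) ≤ 2 * M * (x₂ - w.re) := by gcongr
  nlinarith

/-- A continuous logarithm of a differentiable curve is differentiable. -/
theorem hasDerivAt_of_exp_comp {w g : ℝ → ℂ} {g' : ℂ} {t : ℝ} (hw : ContinuousAt w t)
    (hg : HasDerivAt g g' t) (heq : ∀ᶠ u in 𝓝 t, Complex.exp (w u) = g u) :
    HasDerivAt w (g' / g t) t := by
  have hgt : g t = Complex.exp (w t) := heq.self_of_nhds.symm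
  have hne : g t ≠ 0 := by rw [hgt]; exact Complex.exp_ne_zero _
  -- The principal logarithm is taken of a quotient close to `1`, so this is a differentiable
  -- logarithm of `g`; by continuity `w` agrees with it near `t`.
  have hlog : HasDerivAt (fun u => w t + Complex.log (g u / g t)) (g' / g t / (g t / g t)) t :=
    ((hg.div_const (g t)).clog_real (by rw [div_self hne]; exact Complex.one_mem_slitPlane))
      |>.const_add (w t)
  rw [div_self hne, div_one] at hlog
  refine hlog.congr_of_eventuallyEq ?_
  have him : ∀ᶠ u in 𝓝 t, |(w u - w t).im| < Real.pi := by
    have hc : ContinuousAt (fun u => |(w u - w t).im|) t :=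
      (Complex.continuous_im.continuousAt.comp (hw.sub continuousAt_const)).abs
    refine hc.eventually_lt continuousAt_const ?_
    simpa using Real.pi_pos
  filter_upwards [heq, him] with u hu hi
  rw [← hu, hgt, ← Complex.exp_sub, Complex.log_exp (abs_lt.1 hi).1 (abs_lt.1 hi).2.le]
  ring

end Perron

/-! ### Estimates along the contour and the rays -/

namespace Perron

variable {nb : Set ℂ} {z₀ a p₀ : ℂ} {p φ : ℂ → ℂ} {μ : ℕ} {R : ℝ} {k₁ k₂ : ℤ} {c : ℝ → ℂ}
  {ϑ : ℝ → ℝ} {t₁ t₂ : ℝ}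

theorem exists_pos_forall_le_neg {f : ℝ → ℝ} {u v : ℝ} (hf : ContinuousOn f (Icc u v))
    (hneg : ∀ t ∈ Icc u v, f t < 0) : ∃ δ : ℝ, 0 < δ ∧ ∀ t ∈ Icc u v, f t ≤ -δ := by
  rcases (Icc u v).eq_empty_or_nonempty with he | hne
  · exact ⟨1, one_pos, fun t ht => by simp [he] at ht⟩
  · obtain ⟨x, hx, hmax⟩ := isCompact_Icc.exists_isMaxOn hne hf
    exact ⟨-f x, neg_pos.2 (hneg x hx), fun t ht => by simpa using hmax ht⟩

/-- The integrand of `perronIntegral`, normalized by the factor `exp (-N p z₀)`. -/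
noncomputable def normalizedIntegrand (z₀ a : ℂ) (p q : ℂ → ℂ) (c : ℝ → ℂ) (ϑ : ℝ → ℝ) (N : ℝ)
    (t : ℝ) : ℂ :=
  Complex.exp (N * (p (c t) - p z₀)) * branchPow z₀ a c ϑ t * q (c t) * deriv c t

theorem perronIntegral_eq (z₀ a : ℂ) (p q : ℂ → ℂ) (c : ℝ → ℂ) (ϑ : ℝ → ℝ) (N : ℝ) :
    perronIntegral z₀ a p q c ϑ N =
      Complex.exp (N * p z₀) * ∫ t in (0 : ℝ)..1, normalizedIntegrand z₀ a p q c ϑ N t := by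
  rw [perronIntegral, ← intervalIntegral.integral_const_mul]
  congr 1
  funext t
  rw [normalizedIntegrand, ← mul_assoc, ← mul_assoc, ← mul_assoc, ← Complex.exp_add]
  ring_nf

theorem continuousOn_branchPow {s : Set ℝ} (hc : ContinuousOn c s) (hϑ : ContinuousOn ϑ s)
    (hne : ∀ t ∈ s, c t ≠ z₀) : ContinuousOn (branchPow z₀ a c ϑ) s := by
  unfold branchPow
  refine ContinuousOn.mul (ContinuousOn.cpow ?_ continuousOn_const fun t ht => ?_) ?_
  · exact Complex.continuous_ofReal.comp_continuousOn ((hc.sub continuousOn_const).norm)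
  · exact Complex.ofReal_mem_slitPlane.2 (norm_pos_iff.2 (sub_ne_zero.2 (hne t ht)))
  · exact Complex.continuous_exp.comp_continuousOn ((continuousOn_const.mul
      (Complex.continuous_ofReal.comp_continuousOn hϑ)).mul continuousOn_const)

theorem IsCirclingContour.ne_center (hc : IsCirclingContour z₀ p μ p₀ R k₁ k₂ c ϑ t₁ t₂)
    (hR : 0 < R) {t : ℝ} (ht : t ∈ Icc (0 : ℝ) 1) : c t ≠ z₀ := by
  intro h
  rcases le_total t t₁ with h1 | h1
  · exact (hc.descent_in t ⟨ht.1, h1⟩).ne (by rw [h])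
  rcases le_total t t₂ with h2 | h2
  · have := hc.circle t ⟨h1, h2⟩
    rw [h, sub_self, norm_zero] at this
    exact hR.ne this
  · exact (hc.descent_out t ⟨h2, ht.2⟩).ne (by rw [h])

theorem IsCirclingContour.exp_eq (hc : IsCirclingContour z₀ p μ p₀ R k₁ k₂ c ϑ t₁ t₂)
    (hR : 0 < R) {t : ℝ} (ht : t ∈ Icc t₁ t₂) :
    Complex.exp (Real.log R + ϑ t * Complex.I) = c t - z₀ := by
  have h1 := hc.arg_spec t ⟨hc.t₁_nonneg.trans ht.1, ht.2.trans hc.t₂_le_one⟩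
  rw [hc.circle t ht] at h1
  rw [h1, Complex.exp_add, ← Complex.ofReal_exp, Real.exp_log hR, mul_comm Complex.I]
  ring

theorem IsCirclingContour.intervalIntegrable (hc : IsCirclingContour z₀ p μ p₀ R k₁ k₂ c ϑ t₁ t₂)
    (hR : 0 < R) {q : ℂ → ℂ} (hp : ContinuousOn p (trace c)) (hq : ContinuousOn q (trace c))
    (a : ℂ) (N : ℝ) {u v : ℝ} (hu : u ∈ Icc (0 : ℝ) 1) (hv : v ∈ Icc (0 : ℝ) 1) :
    IntervalIntegrable (normalizedIntegrand z₀ a p q c ϑ N) volume u v := by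
  have hcont := hc.contour.continuousOn
  have hmaps : MapsTo c (Icc 0 1) (trace c) := mapsTo_image c _
  have hsub : uIcc u v ⊆ Icc 0 1 := uIcc_subset_Icc hu hv
  have hint : IntervalIntegrable (deriv c) volume u v :=
    hc.contour.integrable_deriv.mono_set (by rwa [uIcc_of_le zero_le_one])
  refine hint.continuousOn_mul (ContinuousOn.mono ?_ hsub)
  refine ContinuousOn.mul (ContinuousOn.mul ?_ ?_) (hq.comp hcont hmaps)
  · exact Complex.continuous_exp.comp_continuousOn
      (continuousOn_const.mul ((hp.comp hcont hmaps).sub continuousOn_const))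
  · exact continuousOn_branchPow hcont hc.arg_continuous fun t ht => hc.ne_center hR ht

theorem norm_exp_mul_sub_le {N N₀ δ : ℝ} (hN₀ : 0 ≤ N₀) (hN : N₀ ≤ N) {x y : ℂ}
    (h : (x - y).re ≤ -δ) : ‖Complex.exp (N * (x - y))‖ ≤ Real.exp (-δ * N) := by
  rw [Complex.norm_exp, Complex.re_ofReal_mul]
  exact Real.exp_le_exp.2 (by nlinarith [hN₀.trans hN])

/-- Compactness gives a gap `Re (p (c t) - p z₀) ≤ -δ`, and `e^{-δN}` is dominated by any power of
`N` for `N ≥ N₀`. -/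
theorem IsCirclingContour.exists_descent_integral_bound
    (hc : IsCirclingContour z₀ p μ p₀ R k₁ k₂ c ϑ t₁ t₂) (hR : 0 < R)
    (hp : ContinuousOn p (trace c)) {N₀ : ℝ} (hN₀ : 0 < N₀) (a : ℂ) (σ : ℝ) {u v : ℝ}
    (hu : 0 ≤ u) (huv : u ≤ v) (hv : v ≤ 1) (hdesc : ∀ t ∈ Icc u v, (p (c t)).re < (p z₀).re) :
    ∃ C : ℝ, 0 ≤ C ∧ ∀ (q : ℂ → ℂ) (K : ℝ), (∀ z ∈ trace c, ‖q z‖ ≤ K) → ∀ N : ℝ, N₀ ≤ N →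
      ‖∫ t in u..v, normalizedIntegrand z₀ a p q c ϑ N t‖ ≤ C * (K / N ^ σ) := by
  have hsub : Icc u v ⊆ Icc 0 1 := Icc_subset_Icc hu hv
  have hcont := hc.contour.continuousOn.mono hsub
  have hmaps : MapsTo c (Icc u v) (trace c) := (mapsTo_image c _).mono_left hsub
  obtain ⟨δ, hδ, hδ'⟩ := exists_pos_forall_le_neg (f := fun t => (p (c t) - p z₀).re)
    (Complex.continuous_re.comp_continuousOn ((hp.comp hcont hmaps).sub continuousOn_const))
    fun t ht => by simpa using hdesc t ht
  obtain ⟨A, hA⟩ := isCompact_Icc.exists_bound_of_continuousOn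
    (continuousOn_branchPow (a := a) hcont (hc.arg_continuous.mono hsub)
      fun t ht => hc.ne_center hR (hsub ht))
  have hA0 : 0 ≤ A := (norm_nonneg _).trans (hA u (left_mem_Icc.2 huv))
  obtain ⟨D, hD, hD'⟩ := exists_exp_neg_le_rpow hδ hN₀ σ
  have hint : IntervalIntegrable (deriv c) volume u v :=
    hc.contour.integrable_deriv.mono_set (by rw [uIcc_of_le zero_le_one, uIcc_of_le huv]; exact hsub)
  have hL : 0 ≤ ∫ t in u..v, ‖deriv c t‖ :=
    intervalIntegral.integral_nonneg huv fun t _ => norm_nonneg _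
  refine ⟨D * A * ∫ t in u..v, ‖deriv c t‖, by positivity, fun q K hK N hN => ?_⟩
  have hN0 : 0 < N := hN₀.trans_le hN
  have hK0 : 0 ≤ K := (norm_nonneg _).trans (hK (c 0) (mem_image_of_mem c (by simp)))
  refine (intervalIntegral.norm_integral_le_of_norm_le huv
    (g := fun t => D * N ^ (-σ) * A * K * ‖deriv c t‖) (ae_of_all _ fun t ht => ?_)
    (hint.norm.const_mul _)).trans (le_of_eq ?_)
  · have ht' : t ∈ Icc u v := Ioc_subset_Icc_self ht
    rw [normalizedIntegrand, norm_mul, norm_mul, norm_mul]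
    gcongr
    · exact (norm_exp_mul_sub_le hN₀.le hN (hδ' t ht')).trans (hD' N hN)
    · exact hA t ht'
    · exact hK _ (hmaps ht')
  · rw [intervalIntegral.integral_const_mul, Real.rpow_neg hN0.le]
    ring

/-- The differential `exp (N (p z - p z₀)) (z - z₀) ^ (a - 1) q z dz` in the coordinate
`w = log (z - z₀)`. -/
noncomputable def logIntegrand (z₀ a : ℂ) (p q : ℂ → ℂ) (N : ℝ) (w : ℂ) : ℂ :=
  Complex.exp (N * (p (z₀ + Complex.exp w) - p z₀)) * Complex.exp (a * w) * q (z₀ + Complex.exp w)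

theorem differentiableOn_logIntegrand {q : ℂ → ℂ} {R' : ℝ} (hR' : 0 < R')
    (hp : DifferentiableOn ℂ p (Metric.ball z₀ R')) (hq : DifferentiableOn ℂ q (Metric.ball z₀ R'))
    (a : ℂ) (N : ℝ) :
    DifferentiableOn ℂ (logIntegrand z₀ a p q N) {w | w.re < Real.log R'} := by
  have hmaps : MapsTo (fun w => z₀ + Complex.exp w) {w | w.re < Real.log R'}
      (Metric.ball z₀ R') := fun w hw => add_exp_mem_ball_iff.2 ((Real.lt_log_iff_exp_lt hR').1 hw)
  have he : DifferentiableOn ℂ (fun w => z₀ + Complex.exp w) {w | w.re < Real.log R'} := by fun_prop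
  refine DifferentiableOn.mul (DifferentiableOn.mul ?_ (by fun_prop)) (hq.comp he hmaps)
  exact (((hp.comp he hmaps).sub_const _).const_mul _).cexp

/-- The lift `w = log R + iϑ` of the arc is only assumed continuous; being a logarithm of `c - z₀`,
it is differentiable wherever `c` is. The fundamental theorem of calculus then applies off a finite
set. -/
theorem IsCirclingContour.integral_circle
    (hc : IsCirclingContour z₀ p μ p₀ R k₁ k₂ c ϑ t₁ t₂) (hR : 0 < R) {q : ℂ → ℂ}
    (hp : ContinuousOn p (trace c)) (hq : ContinuousOn q (trace c)) (a : ℂ) (N : ℝ) {F : ℂ → ℂ}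
    (hF : ∀ t ∈ Icc t₁ t₂, HasDerivAt F
      (logIntegrand z₀ a p q N (Real.log R + ϑ t * Complex.I)) (Real.log R + ϑ t * Complex.I)) :
    ∫ t in t₁..t₂, normalizedIntegrand z₀ a p q c ϑ N t =
      F (Real.log R + angle p₀ μ k₂ * Complex.I) - F (Real.log R + angle p₀ μ k₁ * Complex.I) := by
  obtain ⟨T, hT⟩ := hc.contour.piecewise_C1
  have h0 := hc.t₁_nonneg
  have h1 := hc.t₁_le_t₂
  have h2 := hc.t₂_le_one
  have hsub : Icc t₁ t₂ ⊆ Icc 0 1 := Icc_subset_Icc h0 h2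
  obtain ⟨w, hwdef⟩ : ∃ w : ℝ → ℂ, ∀ t, Real.log R + ϑ t * Complex.I = w t := ⟨_, fun _ => rfl⟩
  simp only [hwdef] at hF
  have hw : ContinuousOn w (Icc t₁ t₂) := by
    rw [← funext hwdef]
    exact continuousOn_const.add ((Complex.continuous_ofReal.comp_continuousOn
      (hc.arg_continuous.mono hsub)).mul continuousOn_const)
  have hint := hc.intervalIntegrable hR hp hq a N (u := t₁) (v := t₂)
    ⟨h0, h1.trans h2⟩ ⟨h0.trans h1, h2⟩
  rw [← hc.arg_t₁, ← hc.arg_t₂, hwdef, hwdef]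
  have hFw : ContinuousOn (fun t => F (w t)) (Icc t₁ t₂) := fun t ht =>
    ContinuousAt.comp_continuousWithinAt (f := w) (hF t ht).continuousAt (hw t ht)
  have hder : ∀ t ∈ Ioo t₁ t₂ \ (T : Set ℝ), HasDerivAt (fun t => F (w t))
      (normalizedIntegrand z₀ a p q c ϑ N t) t := by
    rintro t ⟨ht, htT⟩
    rw [Finset.mem_coe] at htT
    have htI : t ∈ Icc t₁ t₂ := Ioo_subset_Icc_self ht
    have hcd : HasDerivAt c (deriv c t) t :=
      (hT t ⟨h0.trans_lt ht.1, ht.2.trans_le h2⟩ htT).1.hasDerivAt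
    have hwd : HasDerivAt w (deriv c t / (c t - z₀)) t := by
      refine hasDerivAt_of_exp_comp (g := fun t => c t - z₀) (hw.continuousAt (Icc_mem_nhds ht.1 ht.2))
        (hcd.sub_const z₀) ?_
      filter_upwards [Icc_mem_nhds ht.1 ht.2] with u hu
      rw [← hwdef, hc.exp_eq hR hu]
    have hcomp : HasDerivAt (fun t => F (w t)) _ t := HasDerivAt.comp (h := w) t (hF t htI) hwd
    refine hcomp.congr_deriv ?_
    have hexp := hc.exp_eq hR htI
    rw [hwdef] at hexp
    have hne : c t - z₀ ≠ 0 := sub_ne_zero.2 (hc.ne_center hR (hsub htI))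
    have hRC : (R : ℂ) ≠ 0 := by exact_mod_cast hR.ne'
    have hbr : branchPow z₀ a c ϑ t * (c t - z₀) =
        Complex.exp (a * w t) := by
      rw [branchPow, hc.circle t htI, ← hexp, ← hwdef, Complex.cpow_def_of_ne_zero hRC,
        Complex.ofReal_log hR.le, ← Complex.exp_add, ← Complex.exp_add]
      congr 1
      ring
    rw [logIntegrand, normalizedIntegrand, hexp, add_sub_cancel, ← hbr]
    field_simp
  exact integral_eq_of_hasDerivAt_off_countable_of_le _ _ h1 T.countable_toSet hFw hder hint

theorem IsDescentRadius.exists_radial_bound {ρ : ℝ} (hR : IsDescentRadius nb z₀ p μ p₀ R)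
    (hp : ContinuousOn p (Metric.closedBall z₀ R)) (hρ : 0 < ρ) (hρR : ρ ≤ R) {N₀ : ℝ}
    (hN₀ : 0 < N₀) (a : ℂ) (k : ℤ) (σ : ℝ) :
    ∃ C : ℝ, 0 ≤ C ∧ ∀ (q : ℂ → ℂ) (K : ℝ), (∀ z ∈ Metric.closedBall z₀ R, ‖q z‖ ≤ K) →
      ∀ N : ℝ, N₀ ≤ N → ∀ F : ℂ → ℂ,
      (∀ x ∈ Icc (Real.log ρ) (Real.log R), HasDerivAt F
        (logIntegrand z₀ a p q N (x + angle p₀ μ k * Complex.I)) (x + angle p₀ μ k * Complex.I)) →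
      ‖F (Real.log R + angle p₀ μ k * Complex.I) - F (Real.log ρ + angle p₀ μ k * Complex.I)‖ ≤
        C * (K / N ^ σ) := by
  have hlog : Real.log ρ ≤ Real.log R := Real.log_le_log hρ hρR
  set e : ℝ → ℂ := fun x => z₀ + Complex.exp (x + angle p₀ μ k * Complex.I) with he
  have hecont : Continuous e := by fun_prop
  have hexpR : ∀ x ≤ Real.log R, Real.exp x ≤ R := fun x hx =>
    (Real.exp_le_exp.2 hx).trans (Real.exp_log hR.pos).le
  have hmaps : MapsTo e (Icc (Real.log ρ) (Real.log R)) (Metric.closedBall z₀ R) := fun x hx => by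
    rw [he, add_exp_mem_closedBall_iff]
    simpa using hexpR x hx.2
  obtain ⟨δ, hδ, hδ'⟩ := exists_pos_forall_le_neg (f := fun x => (p (e x) - p z₀).re)
    (Complex.continuous_re.comp_continuousOn
      ((hp.comp hecont.continuousOn hmaps).sub continuousOn_const))
    fun x hx => by
      have := hR.descent k (Real.exp x) ⟨Real.exp_pos x, hexpR x hx.2⟩
      rw [Complex.ofReal_exp, ← Complex.exp_add, mul_comm Complex.I] at this
      simpa [he] using this
  obtain ⟨A, hA⟩ := isCompact_Icc.exists_bound_of_continuousOn (s := Icc (Real.log ρ) (Real.log R))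
    (f := fun x : ℝ => Complex.exp (a * (x + angle p₀ μ k * Complex.I))) (by fun_prop)
  have hA0 : 0 ≤ A := (norm_nonneg _).trans (hA _ (left_mem_Icc.2 hlog))
  obtain ⟨D, hD, hD'⟩ := exists_exp_neg_le_rpow hδ hN₀ σ
  refine ⟨D * A * |Real.log R - Real.log ρ|, by positivity, fun q K hK N hN F hF => ?_⟩
  have hN0 : 0 < N := hN₀.trans_le hN
  rw [← uIcc_of_le hlog] at hF
  refine (norm_sub_le_of_horizontal (A := D * N ^ (-σ) * A * K) hF fun x hx => ?_).trans
    (le_of_eq ?_)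
  · rw [uIcc_of_le hlog] at hx
    rw [logIntegrand, norm_mul, norm_mul]
    gcongr
    · exact (norm_exp_mul_sub_le hN₀.le hN (hδ' x hx)).trans (hD' N hN)
    · exact hA x hx
    · exact hK _ (hmaps hx)
  · rw [Real.rpow_neg hN0.le]
    ring

theorem LocalForm.exists_smallOn (hp : LocalForm nb z₀ p φ μ p₀) (hR : 0 < R)
    (hsub : Metric.closedBall z₀ R ⊆ nb) : ∃ r : ℝ, 0 < r ∧ r ≤ R ∧ SmallOn z₀ φ r := by
  have hcont : ContinuousAt φ z₀ := (hp.phi_holo z₀ (mem_of_mem_nhds hp.nb_mem)).continuousAt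
  have hev : ∀ᶠ z in 𝓝 z₀, ‖φ z‖ < 1 / 2 :=
    hcont.norm.eventually_lt continuousAt_const (by simp [hp.phi_zero])
  obtain ⟨ε, hε, hball⟩ := Metric.eventually_nhds_iff_ball.1 hev
  refine ⟨min ε R, lt_min hε hR, min_le_right _ _, ⟨?_, hp.phi_zero, fun z hz =>
    hball z (Metric.ball_subset_ball (min_le_left _ _) hz)⟩⟩
  exact (hp.phi_holo.differentiableOn).mono
    ((Metric.ball_subset_ball (min_le_right _ _)).trans (Metric.ball_subset_closedBall.trans hsub))

theorem LocalForm.logIntegrand_eq (hp : LocalForm nb z₀ p φ μ p₀) (q : ℂ → ℂ) (a : ℂ) (N : ℝ)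
    {w : ℂ} (hw : z₀ + Complex.exp w ∈ nb) :
    logIntegrand z₀ a p q N w =
      phaseExp z₀ p₀ φ μ N w * Complex.exp (a * w) * q (z₀ + Complex.exp w) := by
  rw [logIntegrand, phaseExp, hp.eq_on _ hw, add_sub_cancel_left, Complex.exp_nat_mul]
  congr 3
  ring

/-- Room beyond radius `R` is needed so that the half-plane of holomorphy contains the line `Re w =
log R`. -/
theorem exists_ball_analytic {f : ℂ → ℂ} (hf : AnalyticOnNhd ℂ f (Metric.closedBall z₀ R))
    (hR : 0 ≤ R) : ∃ R' : ℝ, R < R' ∧ DifferentiableOn ℂ f (Metric.ball z₀ R') := by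
  obtain ⟨δ, hδ, hsub⟩ := (isCompact_closedBall z₀ R).exists_thickening_subset_open
    (isOpen_analyticAt ℂ f) hf
  refine ⟨δ + R, by linarith, ?_⟩
  rw [thickening_closedBall hδ hR] at hsub
  exact fun z hz => (hsub hz).differentiableAt.differentiableWithinAt

end Perron

/-! ### Assembly of the estimates -/

theorem theorem6p3
    (nb : Set ℂ) (z₀ : ℂ) (p φ : ℂ → ℂ) (μ : ℕ) (p₀ : ℂ)
    (hp : Perron.LocalForm nb z₀ p φ μ p₀)
    (R : ℝ) (hR : Perron.IsDescentRadius nb z₀ p μ p₀ R)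
    (k₁ k₂ : ℤ) (c : ℝ → ℂ) (ϑ : ℝ → ℝ) (t₁ t₂ : ℝ)
    (hc : Perron.IsCirclingContour z₀ p μ p₀ R k₁ k₂ c ϑ t₁ t₂)
    (hp_holo : AnalyticOnNhd ℂ p (nb ∪ Perron.trace c))
    (a : ℂ) (S : ℕ) (N₀ : ℝ) (hN₀ : 0 < N₀) :
    ∃ C : ℝ, ∀ (q : ℂ → ℂ) (K : ℝ),
      AnalyticOnNhd ℂ q (nb ∪ Perron.trace c) →
      (∀ z ∈ nb ∪ Perron.trace c, ‖q z‖ ≤ K) →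
      ∀ N : ℝ, N₀ ≤ N → ∃ E : ℂ,
        Perron.perronIntegral z₀ a p q c ϑ N =
          Complex.exp (N * p z₀) *
            (∑ s ∈ Finset.range S,
              Perron.gammaFactor a μ k₁ k₂ s * Perron.alpha z₀ a q φ μ p₀ s /
                (N : ℂ) ^ (((s : ℂ) + a) / (μ : ℂ)) + E) ∧
        ‖E‖ ≤ C * (K / N ^ (((S : ℝ) + a.re) / (μ : ℝ))) := by
  have hR0 := hR.pos
  have h0 := hc.t₁_nonneg
  have h1 := hc.t₁_le_t₂
  have h2 := hc.t₂_le_one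
  obtain ⟨r, hr, hrR, hsmall⟩ := hp.exists_smallOn hR0 hR.disk_subset
  set ρ : ℝ := r / 2 with hρdef
  have hρ : 0 < ρ := by positivity
  have hρr : ρ < r := by rw [hρdef]; linarith
  have hρR : ρ ≤ R := hρr.le.trans hrR
  have hpnb : AnalyticOnNhd ℂ p (Metric.closedBall z₀ R) :=
    hp_holo.mono (hR.disk_subset.trans subset_union_left)
  have hptr : ContinuousOn p (Perron.trace c) := (hp_holo.mono subset_union_right).continuousOn
  set σ : ℝ := ((S : ℝ) + a.re) / (μ : ℝ) with hσ
  obtain ⟨C₁, -, hC₁⟩ := hc.exists_descent_integral_bound hR0 hptr hN₀ a σ le_rfl h0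
    (h1.trans h2) hc.descent_in
  obtain ⟨C₂, -, hC₂⟩ := hc.exists_descent_integral_bound hR0 hptr hN₀ a σ (h0.trans h1) h2
    le_rfl hc.descent_out
  obtain ⟨C₃, -, hC₃⟩ := hR.exists_radial_bound hpnb.continuousOn hρ hρR hN₀ a k₁ σ
  obtain ⟨C₄, -, hC₄⟩ := hR.exists_radial_bound hpnb.continuousOn hρ hρR hN₀ a k₂ σ
  obtain ⟨C₅, -, hC₅⟩ :=
    hsmall.exists_local_asymptotics hp.mu_pos hp.p₀_ne hρ hρr hN₀ a k₁ k₂ S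
  -- Bounding `ϑ` on the whole contour gives a rectangle containing the lifted arc, even if it moves
  -- back and forth, as well as both rays.
  obtain ⟨Y, hY⟩ := isCompact_Icc.exists_bound_of_continuousOn hc.arg_continuous
  refine ⟨C₁ + C₂ + C₃ + C₄ + C₅, fun q K hq hK N hN => ?_⟩
  have hqnb : AnalyticOnNhd ℂ q (Metric.closedBall z₀ R) :=
    hq.mono (hR.disk_subset.trans subset_union_left)
  have hqtr : ContinuousOn q (Perron.trace c) := (hq.mono subset_union_right).continuousOn
  have hKtr : ∀ z ∈ Perron.trace c, ‖q z‖ ≤ K := fun z hz => hK z (subset_union_right hz)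
  have hKnb : ∀ z ∈ Metric.closedBall z₀ R, ‖q z‖ ≤ K := fun z hz =>
    hK z (subset_union_left (hR.disk_subset hz))
  have hballR : Metric.ball z₀ r ⊆ Metric.closedBall z₀ R :=
    (Metric.ball_subset_ball hrR).trans Metric.ball_subset_closedBall
  obtain ⟨R₁, hR₁, hpd⟩ := Perron.exists_ball_analytic hpnb hR0.le
  obtain ⟨R₂, hR₂, hqd⟩ := Perron.exists_ball_analytic hqnb hR0.le
  have hRR : R < min R₁ R₂ := lt_min hR₁ hR₂
  have hdiff := Perron.differentiableOn_logIntegrand (hR0.trans hRR)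
    (hpd.mono (Metric.ball_subset_ball (min_le_left _ _)))
    (hqd.mono (Metric.ball_subset_ball (min_le_right _ _))) a N
  -- `F` depends on `q` and `N`, also through the left edge of the rectangle; the constants `C₁` to
  -- `C₅` were fixed beforehand.
  obtain ⟨F, hF⟩ := Perron.exists_primitive_on_rect
    (x₀ := Real.log ρ - Real.log (N / N₀) / μ) (Y := Y) (Real.log_lt_log hR0 hRR) hdiff
  have hlog : Real.log ρ ≤ Real.log R := Real.log_le_log hρ hρR
  have hτ : 0 ≤ Real.log (N / N₀) / μ :=
    div_nonneg (Real.log_nonneg ((one_le_div hN₀).2 hN)) (Nat.cast_nonneg _)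
  have hY₁ : |Perron.angle p₀ μ k₁| ≤ Y := by
    rw [← hc.arg_t₁]; exact hY t₁ ⟨h0, h1.trans h2⟩
  have hY₂ : |Perron.angle p₀ μ k₂| ≤ Y := by
    rw [← hc.arg_t₂]; exact hY t₂ ⟨h0.trans h1, h2⟩
  have hIn := hC₁ q K hKtr N hN
  have hOut := hC₂ q K hKtr N hN
  have hRad₁ := hC₃ q K hKnb N hN F fun x hx =>
    hF _ (by simp; linarith [hx.1]) (by simpa using hx.2) (by simpa using hY₁)
  have hRad₂ := hC₄ q K hKnb N hN F fun x hx =>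
    hF _ (by simp; linarith [hx.1]) (by simpa using hx.2) (by simpa using hY₂)
  have hLoc := hC₅ q K (hqnb.differentiableOn.mono hballR) (fun z hz => hKnb z (hballR hz)) N hN F
    fun w hw => by
      have hwR : w.re ≤ Real.log R := hw.1.2.trans hlog
      rw [← hp.logIntegrand_eq q a N (hR.disk_subset (Perron.add_exp_mem_closedBall_iff.2
        ((Real.exp_le_exp.2 hwR).trans (Real.exp_log hR0).le)))]
      refine hF w hw.1.1 hwR ?_
      have hY₁' := abs_le.1 hY₁
      have hY₂' := abs_le.1 hY₂
      have := uIcc_subset_Icc (⟨hY₁'.1, hY₁'.2⟩ : _ ∈ Icc (-Y) Y) ⟨hY₂'.1, hY₂'.2⟩ hw.2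
      exact abs_le.2 this
  have hCirc := hc.integral_circle hR0 hptr hqtr a N (F := F) fun t ht =>
    hF _ (by simp; linarith) (by simp) (by
      simpa using hY t ⟨h0.trans ht.1, ht.2.trans h2⟩)
  have hint := fun (u v : ℝ) (hu : u ∈ Icc (0 : ℝ) 1) (hv : v ∈ Icc (0 : ℝ) 1) =>
    hc.intervalIntegrable hR0 hptr hqtr a N hu hv
  have m0 : (0 : ℝ) ∈ Icc (0 : ℝ) 1 := by simp
  have m1 : (1 : ℝ) ∈ Icc (0 : ℝ) 1 := by simp
  have mt₁ : t₁ ∈ Icc (0 : ℝ) 1 := ⟨h0, h1.trans h2⟩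
  have mt₂ : t₂ ∈ Icc (0 : ℝ) 1 := ⟨h0.trans h1, h2⟩
  have hsplit := intervalIntegral.integral_add_adjacent_intervals (hint 0 t₂ m0 mt₂)
    (hint t₂ 1 mt₂ m1)
  rw [← intervalIntegral.integral_add_adjacent_intervals (hint 0 t₁ m0 mt₁)
    (hint t₁ t₂ mt₁ mt₂), hCirc] at hsplit
  refine ⟨(∫ t in (0 : ℝ)..1, Perron.normalizedIntegrand z₀ a p q c ϑ N t) -
    ∑ s ∈ Finset.range S, Perron.gammaFactor a μ k₁ k₂ s * Perron.alpha z₀ a q φ μ p₀ s /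
      (N : ℂ) ^ (((s : ℂ) + a) / (μ : ℂ)), ?_, ?_⟩
  · rw [Perron.perronIntegral_eq, add_sub_cancel]
  · rw [← hsplit]
    set I₁ := ∫ t in (0 : ℝ)..t₁, Perron.normalizedIntegrand z₀ a p q c ϑ N t
    set I₃ := ∫ t in t₂..(1 : ℝ), Perron.normalizedIntegrand z₀ a p q c ϑ N t
    set T := ∑ s ∈ Finset.range S, Perron.gammaFactor a μ k₁ k₂ s *
      Perron.alpha z₀ a q φ μ p₀ s / (N : ℂ) ^ (((s : ℂ) + a) / (μ : ℂ))
    set A₁ := F (Real.log R + Perron.angle p₀ μ k₁ * Complex.I)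
    set A₂ := F (Real.log R + Perron.angle p₀ μ k₂ * Complex.I)
    set B₁ := F (Real.log ρ + Perron.angle p₀ μ k₁ * Complex.I)
    set B₂ := F (Real.log ρ + Perron.angle p₀ μ k₂ * Complex.I)
    -- Two outer parts, two radial parts between `R` and `ρ`, and the local increment minus its
    -- expansion.
    have hdecomp : I₁ + (A₂ - A₁) + I₃ - T =
        I₁ + I₃ + -(A₁ - B₁) + (A₂ - B₂) + (B₂ - B₁ - T) := by ring
    rw [hdecomp]
    refine (norm_add_le _ _).trans ?_
    have e1 := norm_add_le (I₁ + I₃ + -(A₁ - B₁)) (A₂ - B₂)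
    have e2 := norm_add_le (I₁ + I₃) (-(A₁ - B₁))
    have e3 := norm_add_le I₁ I₃
    rw [norm_neg] at e2
    linarith
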